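/- Let $(\Omega,\mathcal F_\infty,\mathbb P)$ be a probability space with a filtration $(\mathcal F_t)_{t\in\{0,1,2,\dots\}}$, and let $P=(P_t)_{t\ge 0}$ be an adapted process with values in $\mathbb R^n$ (the prices of $n$ assets; no sign condition is imposed and no numéraire is assumed). Inequalities and positivity of random variables are understood almost surely. An *investment-consumption strategy* is an $n$-dimensional predictable process $H=(H_t)_{t\ge1}$ (so $H_{t+1}$ is $\mathcal F_t$-measurable for all $t \ge 0$) with $H_t\cdot P_t\ge H_{t+1}\cdot P_t$ almost surely for all $t\ge1$. An *investment-consumption arbitrage* is an investment-consumption strategy $H$ for which there is a non-random $T>0$ such that $H_1\cdot P_0\le 0$ and $H_{T+1}=0$ almost surely, and, with $H_0=0$, $$\mathbb P\big((H_t-H_{t+1})\cdot P_t>0\ \text{for some } 0\le t\le T\big)>0 .$$ A *local martingale* is an adapted process $M$ for which there are stopping times $\tau_N\uparrow\infty$ such that each stopped process $(M_{t\wedge\tau_N})_{t\ge0}$ is a martingale. A *(local) martingale deflator* is a strictly positive adapted real-valued process $Y=(Y_t)_{t\ge0}$ such that $(P_tY_t)_{t\ge0}$ is a (local) martingale; a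 martingale deflator $(Y_t)_{0\le t\le T}$ is defined in the same way on the time set $\{0,\dots,T\}$. For a sub-$\sigma$-field $\mathcal G$ and a real random variable $X$ with $\mathbb E(|X|\,|\,\mathcal G)<\infty$ almost surely, the *generalised conditional expectation* is $\mathbb E(X|\mathcal G)=\mathbb E(X^+|\mathcal G)-\mathbb E(X^-|\mathcal G)$; for random vectors it is taken componentwise. **Theorem.** The following are equivalent: 1. The market has no investment-consumption arbitrage. 2. There exists a local martingale deflator. 3. There exists a martingale deflator. 4. For every non-random $T>0$ and every positive adapted process $(\eta_t)_{0\le t\le T}$ there exists a martingale deflator $(Y_t)_{0\le t\le T}$ such that $Y_t\le\eta_t$ almost surely for all $0\le t\le T$. 5. For every $t\ge1$ and every positive $\mathcal F_t$-measurable random variable $\zeta$ there exist a positive $\mathcal F_t$-measurable random variable $Z$ and a positive $\mathcal F_{t-1}$-measurable random variable $R$ such that $Z\le R\,\zeta$ almost surely and $$\mathbb E(P_tZ\,|\,\mathcal F_{t-1})=P_{t-1}$$ in the sense of generalised conditional expectation (in particular $\mathbb E(|P^i_tZ|\,|\,\mathcal F_{t-1})<\infty$ almost surely for every $i$). -/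

import Mathlib

open MeasureTheory ProbabilityTheory
open scoped ENNReal

namespace NumeraireFree

variable {Ω : Type*} {m : MeasurableSpace Ω} {n : ℕ}

/-- An investment-consumption strategy: a predictable process `H` (only `H t` for `t ≥ 1` matters)
satisfying the self-financing condition `H_{t+1} · P_t ≤ H_t · P_t` almost surely for `t ≥ 1`. -/
structure IsStrategy (𝓕 : Filtration ℕ m) (μ : Measure Ω) (P : ℕ → Ω → (Fin n → ℝ))
    (H : ℕ → Ω → (Fin n → ℝ)) : Prop where
  predictable : IsStronglyPredictable 𝓕 H
  selfFinancing : ∀ t : ℕ, 1 ≤ t → ∀ᵐ ω ∂μ, H (t + 1) ω ⬝ᵥ P t ω ≤ H t ω ⬝ᵥ P t ω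

/-- The set of strategies which are feasible for the initial wealth `X₀` and the horizon `T`. -/
def feasible (𝓕 : Filtration ℕ m) (μ : Measure Ω) (P : ℕ → Ω → (Fin n → ℝ)) (X₀ : ℝ) (T : ℕ) :
    Set (ℕ → Ω → (Fin n → ℝ)) :=
  {H | IsStrategy 𝓕 μ P H ∧ (∀ᵐ ω ∂μ, H 1 ω ⬝ᵥ P 0 ω ≤ X₀) ∧ (∀ᵐ ω ∂μ, H (T + 1) ω = 0)}

/-- An investment-consumption arbitrage, with the convention `H_0 = 0`. -/
def IsArbitrage (𝓕 : Filtration ℕ m) (μ : Measure Ω) (P : ℕ → Ω → (Fin n → ℝ))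
    (H : ℕ → Ω → (Fin n → ℝ)) : Prop :=
  H 0 = 0 ∧ ∃ T : ℕ, 0 < T ∧ H ∈ feasible 𝓕 μ P 0 T ∧
    0 < μ {ω | ∃ t : ℕ, t ≤ T ∧ 0 < (H t ω - H (t + 1) ω) ⬝ᵥ P t ω}

/-- A local martingale: an adapted process `M` for which there are stopping times `τ N`, increasing
to infinity, such that each stopped process `M^{τ N}` is a martingale. -/
def IsLocalMartingale {E : Type*} [NormedAddCommGroup E] [NormedSpace ℝ E] [CompleteSpace E]
    (M : ℕ → Ω → E) (𝓕 : Filtration ℕ m) (μ : Measure Ω) : Prop :=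
  StronglyAdapted 𝓕 M ∧ ∃ τ : ℕ → Ω → WithTop ℕ, IsLocalizingSequence 𝓕 τ μ ∧
    ∀ N, Martingale (stoppedProcess M (τ N)) 𝓕 μ

/-- A local martingale deflator: a strictly positive adapted process `Y` such that the
`n`-dimensional process `P Y` is a local martingale. -/
structure IsLocalMartingaleDeflator (𝓕 : Filtration ℕ m) (μ : Measure Ω)
    (P : ℕ → Ω → (Fin n → ℝ)) (Y : ℕ → Ω → ℝ) : Prop where
  adapted : StronglyAdapted 𝓕 Y
  pos : ∀ t, ∀ᵐ ω ∂μ, 0 < Y t ω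
  localMartingale : IsLocalMartingale (fun t ω => Y t ω • P t ω) 𝓕 μ

/-- A martingale deflator over the infinite horizon. -/
structure IsMartingaleDeflator (𝓕 : Filtration ℕ m) (μ : Measure Ω)
    (P : ℕ → Ω → (Fin n → ℝ)) (Y : ℕ → Ω → ℝ) : Prop where
  adapted : StronglyAdapted 𝓕 Y
  pos : ∀ t, ∀ᵐ ω ∂μ, 0 < Y t ω
  martingale : Martingale (fun t ω => Y t ω • P t ω) 𝓕 μ

/-- A martingale deflator `(Y_t)` over the time set `0 ≤ t ≤ T`: it is adapted and strictly positive
there, and `P Y` is a martingale on this time set. The values `Y t` for `t > T` do not matter. -/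
structure IsMartingaleDeflatorUpTo (𝓕 : Filtration ℕ m) (μ : Measure Ω)
    (P : ℕ → Ω → (Fin n → ℝ)) (T : ℕ) (Y : ℕ → Ω → ℝ) : Prop where
  adapted : ∀ t ≤ T, StronglyMeasurable[𝓕 t] (Y t)
  pos : ∀ t ≤ T, ∀ᵐ ω ∂μ, 0 < Y t ω
  integrable : ∀ t ≤ T, Integrable (fun ω => Y t ω • P t ω) μ
  martingale : ∀ s t : ℕ, s ≤ t → t ≤ T →
    μ[fun ω => Y t ω • P t ω | 𝓕 s] =ᵐ[μ] fun ω => Y s ω • P s ω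

/-- `𝔼(X | 𝒢) = W` in the sense of generalised conditional expectation: `𝔼(|X| | 𝒢)` is almost
surely finite (`X` itself need not be integrable) and `W = 𝔼(X⁺ | 𝒢) - 𝔼(X⁻ | 𝒢)` almost surely,
where the conditional expectations of non-negative variables take values in `[0, ∞]`. -/
def HasGenCondExp (μ : Measure Ω) (𝒢 : MeasurableSpace Ω) (X W : Ω → ℝ) : Prop :=
  (∀ᵐ ω ∂μ, condLExp 𝒢 μ (fun ω' => ENNReal.ofReal |X ω'|) ω < ∞) ∧
  ∀ᵐ ω ∂μ, W ω = (condLExp 𝒢 μ (fun ω' => ENNReal.ofReal (X ω')) ω).toReal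
    - (condLExp 𝒢 μ (fun ω' => ENNReal.ofReal (-X ω')) ω).toReal

end NumeraireFree

/-! Everything passes through absence of arbitrage in each single period, `OneStepNA`.

From deflators to no arbitrage: a one-period martingale has `OneStepNA`, since a bounded portfolio
has the same mean value at both dates, non-positive at one and non-negative at the other.
Localisation extends this to local martingales, and positive factors are harmless. Over many
periods, backward induction shows that every portfolio of a candidate arbitrage has non-negative
cost; forward induction from zero wealth then makes all values vanish.

From no arbitrage to the one-step condition (`OneStepNA.exists_hasGenCondExp`): let κ be the
conditional law of ζP₁ given the past, and add to it a unit atom at -P₀. Almost surely, no h has h ·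
q ≥ 0 almost everywhere under this measure without equality; measurable selection makes the
statement pointwise. After rescaling q into the unit cube, the integral of √(1 + (h · q)²) - h · q
has a minimiser. The gradient vanishes there: the mean of q with a bounded positive weight is 0.
Moving the atom to the other side writes P₀ as a weighted conditional mean of ζP₁, and boundedness
of the weight gives Z ≤ Rζ.

Small deflators on a finite horizon: a bound at time T + 1 costs a factor R known at time T,
absorbed by asking the deflator at time T to lie below 1/R.

Infinite horizon: the products of the one-step Z give a deflator that is a martingale only in the
generalised sense (`IsGenMartingale`), and one process must be made integrable at all times.
`IsGenMartingale.exists_martingale` multiplies by infinitely many density processes. The k-th makes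
the variable at time k integrable, preserves the generalised martingale property, is at most 1 + 2⁻ᵏ
and within 2⁻ᵏ of 1 in L¹ at every time. The infinite product therefore converges to a positive
limit, and dominated convergence yields a true martingale. Each density truncates mildly and then
repairs the conditional mean by a small bounded correction (`exists_tilt`). -/

namespace NumeraireFree

/-! ### Measurable selection of zeros -/

section Selection

variable {α : Type*} [MeasurableSpace α]

/-- By compactness a zero exists as soon as the values on a countable dense subset of `C` come
arbitrarily close to 0, which is a countable condition on `a`. -/
lemma measurableSet_exists_zero {E : Type*} [TopologicalSpace E] [SecondCountableTopology E]
    {G : α → E → ℝ} (hm : ∀ h, Measurable fun a => G a h) (hc : ∀ a, Continuous (G a))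
    (h0 : ∀ a h, 0 ≤ G a h) {C : Set E} (hC : IsCompact C) :
    MeasurableSet {a | ∃ h ∈ C, G a h = 0} := by
  obtain ⟨D, hDc, hDd⟩ := TopologicalSpace.exists_countable_dense C
  have key : {a | ∃ h ∈ C, G a h = 0} =
      ⋂ j : ℕ, ⋃ q ∈ D, {a | G a (q : C) < 1 / ((j : ℝ) + 1)} := by
    ext a
    simp only [Set.mem_ofPred_eq, Set.mem_iInter, Set.mem_iUnion, exists_prop]
    constructor
    · rintro ⟨h, hh, hG⟩ j
      have ho : IsOpen {x : C | G a x < 1 / ((j : ℝ) + 1)} :=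
        isOpen_lt ((hc a).comp continuous_subtype_val) continuous_const
      obtain ⟨q, hq1, hq2⟩ := hDd.exists_mem_open ho
        ⟨⟨h, hh⟩, by simp only [Set.mem_ofPred_eq, hG]; positivity⟩
      exact ⟨q, hq1, hq2⟩
    · intro hj
      obtain ⟨q0, -, -⟩ := hj 0
      obtain ⟨x, hx, hmin⟩ := hC.exists_isMinOn ⟨q0, q0.2⟩ (hc a).continuousOn
      refine ⟨x, hx, le_antisymm ?_ (h0 a x)⟩
      refine ge_of_tendsto' tendsto_one_div_add_atTop_nhds_zero_nat fun j => ?_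
      obtain ⟨q, -, hq⟩ := hj j
      exact (hmin q.2).trans hq.le
  rw [key]
  exact MeasurableSet.iInter fun j => MeasurableSet.biUnion hDc fun q _ =>
    measurableSet_lt (hm _) measurable_const

/-- Measurable selection of a zero in a compact set, by lexicographic minimisation. -/
lemma exists_measurable_zero_of_isCompact {ι : Type*} [Fintype ι] {G : α → (ι → ℝ) → ℝ}
    (hm : ∀ h, Measurable fun a => G a h) (hc : ∀ a, Continuous (G a))
    (h0 : ∀ a h, 0 ≤ G a h) {C : Set (ι → ℝ)} (hC : IsCompact C) :
    ∃ y : α → ι → ℝ, Measurable y ∧ ∀ a, (∃ h ∈ C, G a h = 0) → G a (y a) = 0 := by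
  classical
  -- Coordinates are fixed one at a time; the invariant is that those in `s` agree with the
  -- coordinates of an actual zero in `C`.
  suffices H : ∀ s : Finset ι, ∃ y : α → ι → ℝ, Measurable y ∧
      ∀ a, (∃ h ∈ C, G a h = 0) → ∃ h ∈ C, G a h = 0 ∧ ∀ i ∈ s, h i = y a i by
    obtain ⟨y, hy, hy'⟩ := H Finset.univ
    refine ⟨y, hy, fun a ha => ?_⟩
    obtain ⟨h, -, hG, hi⟩ := hy' a ha
    rwa [← funext fun i => hi i (Finset.mem_univ i)]
  intro s
  induction s using Finset.induction_on with
  | empty =>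
    exact ⟨fun _ => 0, measurable_const, fun a ⟨h, hh, hG⟩ => ⟨h, hh, hG, by simp⟩⟩
  | insert i s his ih =>
    obtain ⟨y, hy, hy'⟩ := ih
    -- The penalty forces zeros of `G'` to be zeros of `G` with the coordinates already chosen.
    set G' : α → (ι → ℝ) → ℝ := fun a h => G a h + ∑ j ∈ s, |h j - y a j| with hG'
    have hm' : ∀ h, Measurable fun a => G' a h := fun h => by
      have : ∀ j, Measurable fun a => y a j := fun j => (measurable_pi_apply j).comp hy
      fun_prop
    have hc' : ∀ a, Continuous (G' a) := fun a => by
      have := hc a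
      fun_prop
    have hs0 : ∀ a (h : ι → ℝ), 0 ≤ ∑ j ∈ s, |h j - y a j| :=
      fun a h => Finset.sum_nonneg fun _ _ => abs_nonneg _
    have h0' : ∀ a h, 0 ≤ G' a h := fun a h => add_nonneg (h0 a h) (hs0 a h)
    have hzero : ∀ a h, G' a h = 0 ↔ G a h = 0 ∧ ∀ j ∈ s, h j = y a j := by
      intro a h
      rw [hG', add_eq_zero_iff_of_nonneg (h0 a h) (hs0 a h),
        Finset.sum_eq_zero_iff_of_nonneg fun _ _ => abs_nonneg _]
      simp [sub_eq_zero]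
    set Z : α → Set (ι → ℝ) := fun a => {h | h ∈ C ∧ G' a h = 0} with hZ
    have hZc : ∀ a, IsCompact (Z a) := fun a =>
      hC.inter_right ((isClosed_singleton (x := (0 : ℝ))).preimage (hc' a))
    set S : Set α := {a | ∃ h ∈ C, G' a h = 0} with hS
    have hSm : MeasurableSet S := measurableSet_exists_zero hm' hc' h0' hC
    have hmin : ∀ a ∈ S, ∃ h ∈ Z a, ∀ h' ∈ Z a, h i ≤ h' i := fun a ⟨h, hh, hG⟩ =>
      (hZc a).exists_isMinOn ⟨h, hh, hG⟩ (continuous_apply i).continuousOn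
    choose! z hz hzmin using hmin
    set w : α → ℝ := S.indicator fun a => z a i with hw
    -- A minimum is at most `c` exactly when some zero lies in `C ∩ {h | h i ≤ c}`, again a compact
    -- set. The second piece accounts for the default value 0 off `S`.
    have hwm : Measurable w := by
      refine measurable_of_Iic fun c => ?_
      have hcm : MeasurableSet {a | ∃ h ∈ C ∩ {h | h i ≤ c}, G' a h = 0} :=
        measurableSet_exists_zero hm' hc' h0'
          (hC.inter_right (isClosed_le (continuous_apply i) continuous_const))
      have : w ⁻¹' Set.Iic c = {a | ∃ h ∈ C ∩ {h | h i ≤ c}, G' a h = 0} ∪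
          (Sᶜ ∩ {_a | (0 : ℝ) ≤ c}) := by
        ext a
        by_cases ha : a ∈ S
        · simp only [Set.mem_preimage, hw, Set.indicator_of_mem ha, Set.mem_Iic, Set.mem_union,
            Set.mem_ofPred_eq, Set.mem_inter_iff, Set.mem_compl_iff, ha, not_true, false_and,
            or_false]
          exact ⟨fun h => ⟨z a, ⟨(hz a ha).1, h⟩, (hz a ha).2⟩,
            fun ⟨h, hh, hG⟩ => (hzmin a ha h ⟨hh.1, hG⟩).trans hh.2⟩
        · simp only [Set.mem_preimage, hw, Set.indicator_of_notMem ha, Set.mem_Iic, Set.mem_union,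
            Set.mem_ofPred_eq, Set.mem_inter_iff, Set.mem_compl_iff, ha, not_false_iff, true_and]
          exact ⟨Or.inr, fun h => h.resolve_left fun ⟨h, hh, hG⟩ => ha ⟨h, hh.1, hG⟩⟩
      rw [this]
      exact hcm.union (hSm.compl.inter (MeasurableSet.const _))
    refine ⟨fun a => Function.update (y a) i (w a), ?_, fun a ha => ?_⟩
    · refine measurable_pi_iff.2 fun j => ?_
      by_cases hj : j = i
      · subst hj; simpa using hwm
      · simp only [Function.update_of_ne hj]
        exact (measurable_pi_apply j).comp hy
    · obtain ⟨h, hhC, hG, hhs⟩ := hy' a ha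
      have haS : a ∈ S := ⟨h, hhC, (hzero a h).2 ⟨hG, hhs⟩⟩
      obtain ⟨hzG, hzs⟩ := (hzero a (z a)).1 (hz a haS).2
      refine ⟨z a, (hz a haS).1, hzG, fun j hj => ?_⟩
      rcases Finset.mem_insert.1 hj with rfl | hj
      · simp [hw, Set.indicator_of_mem haS]
      · have hji : j ≠ i := fun h => his (h ▸ hj)
        simpa only [Function.update_of_ne hji] using hzs j hj

/-- The space is exhausted by closed balls, and the selection belonging to the first ball that
contains a zero is used. -/
lemma exists_measurable_zero_pi {ι : Type*} [Fintype ι] {G : α → (ι → ℝ) → ℝ}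
    (hm : ∀ h, Measurable fun a => G a h) (hc : ∀ a, Continuous (G a))
    (h0 : ∀ a h, 0 ≤ G a h) :
    ∃ y : α → ι → ℝ, Measurable y ∧ ∀ a, (∃ h, G a h = 0) → G a (y a) = 0 := by
  classical
  have hC : ∀ N : ℕ, IsCompact (Metric.closedBall (0 : ι → ℝ) N) :=
    fun N => isCompact_closedBall _ _
  choose y hy hy' using fun N => exists_measurable_zero_of_isCompact hm hc h0 (hC N)
  set S : ℕ → Set α := fun N => {a | ∃ h ∈ Metric.closedBall (0 : ι → ℝ) N, G a h = 0}
  have hS : ∀ N, MeasurableSet (S N) := fun N => measurableSet_exists_zero hm hc h0 (hC N)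
  -- The complement makes the search stop at once when there is no zero at all.
  have hex : ∀ a, ∃ N, a ∈ S N ∪ (⋃ N, S N)ᶜ := fun a => by
    by_cases h : a ∈ ⋃ N, S N
    · obtain ⟨N, hN⟩ := Set.mem_iUnion.1 h
      exact ⟨N, Or.inl hN⟩
    · exact ⟨0, Or.inr h⟩
  have : ∀ N, DecidablePred (· ∈ S N ∪ (⋃ N, S N)ᶜ) := fun N => Classical.decPred _
  refine ⟨_, Measurable.find (p := fun N a => a ∈ S N ∪ (⋃ N, S N)ᶜ) hy
    (fun N => (hS N).union (MeasurableSet.iUnion hS).compl) hex,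
    fun a ⟨h, hG⟩ => hy' _ a ?_⟩
  refine (Nat.find_spec (hex a)).resolve_right fun hn => hn ?_
  obtain ⟨N, hN⟩ := exists_nat_ge ‖h‖
  exact Set.mem_iUnion.2 ⟨N, h, by simpa using hN, hG⟩

/-- Measurable selection of a zero of a non-negative Carathéodory function. -/
lemma exists_measurable_zero {E : Type*} [NormedAddCommGroup E] [NormedSpace ℝ E]
    [FiniteDimensional ℝ E] [MeasurableSpace E] [BorelSpace E] {G : α → E → ℝ}
    (hm : ∀ h, Measurable fun a => G a h) (hc : ∀ a, Continuous (G a))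
    (h0 : ∀ a h, 0 ≤ G a h) :
    ∃ y : α → E, Measurable y ∧ ∀ a, (∃ h, G a h = 0) → G a (y a) = 0 := by
  let e := (Module.finBasis ℝ E).equivFunL
  obtain ⟨y, hy, hy'⟩ := exists_measurable_zero_pi (G := fun a h => G a (e.symm h))
    (fun h => hm _) (fun a => (hc a).comp e.symm.continuous) fun a h => h0 a _
  exact ⟨fun a => e.symm (y a), e.symm.continuous.measurable.comp hy,
    fun a ⟨h, hG⟩ => hy' a ⟨e h, by simpa using hG⟩⟩

end Selection

/-! ### Generalised conditional expectations and conditional laws -/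

section GenCondExp

variable {Ω : Type*} {mG mΩ : MeasurableSpace Ω} {μ : Measure Ω}

/-- Pulling a measurable factor out of the Lebesgue conditional expectation. -/
lemma condLExp_mul_left [IsFiniteMeasure μ] (hm : mG ≤ mΩ) {g X : Ω → ℝ≥0∞} (hg : Measurable[mG] g)
    (hX : AEMeasurable X μ) :
    condLExp mG μ (fun ω => g ω * X ω) =ᵐ[μ] fun ω => g ω * condLExp mG μ X ω := by
  refine (ae_eq_condLExp hm μ _ (hg.mul (measurable_condLExp _ _ _)) fun s hs => ?_).symm
  -- The measures with densities `X` and its conditional expectation agree on `mG`, hence give every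
  -- `mG`-measurable `g` the same integral.
  have htrim : (μ.withDensity (condLExp mG μ X)).trim hm = (μ.withDensity X).trim hm := by
    refine @Measure.ext _ mG _ _ fun t ht => ?_
    rw [trim_measurableSet_eq hm ht, trim_measurableSet_eq hm ht, withDensity_apply _ (hm t ht),
      withDensity_apply _ (hm t ht), setLIntegral_condLExp hm μ X ht]
  have hgs : Measurable[mG] (s.indicator g) := hg.indicator hs
  have key : ∀ Z : Ω → ℝ≥0∞, AEMeasurable Z μ →
      ∫⁻ ω in s, g ω * Z ω ∂μ = ∫⁻ ω, s.indicator g ω ∂((μ.withDensity Z).trim hm) := by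
    intro Z hZ
    rw [lintegral_trim hm hgs,
      lintegral_withDensity_eq_lintegral_mul₀ hZ (hgs.mono hm le_rfl).aemeasurable,
      ← lintegral_indicator (hm s hs)]
    refine lintegral_congr fun ω => ?_
    by_cases h : ω ∈ s <;> simp [h, mul_comm]
  exact (key _ (measurable_condLExp' _ _ _).aemeasurable).trans (by rw [htrim, ← key _ hX])

lemma HasGenCondExp.congr {X X' W W' : Ω → ℝ} (h : HasGenCondExp μ mG X W) (hX : X =ᵐ[μ] X')
    (hW : W =ᵐ[μ] W') : HasGenCondExp μ mG X' W' := by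
  have h1 := condLExp_congr_ae (mΩ := mG)
    (hX.fun_comp fun x => ENNReal.ofReal |x|)
  have h2 := condLExp_congr_ae (mΩ := mG) (hX.fun_comp fun x => ENNReal.ofReal x)
  have h3 := condLExp_congr_ae (mΩ := mG) (hX.fun_comp fun x => ENNReal.ofReal (-x))
  refine ⟨?_, ?_⟩
  · filter_upwards [h.1, h1] with ω a b
    exact b ▸ a
  · filter_upwards [h.2, h2, h3, hW] with ω a b c d
    rw [← d, a]
    exact congrArg₂ (fun x y : ℝ≥0∞ => x.toReal - y.toReal) b c

lemma HasGenCondExp.mul_left [IsFiniteMeasure μ] (hm : mG ≤ mΩ) {g X W : Ω → ℝ}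
    (h : HasGenCondExp μ mG X W)
    (hX : AEMeasurable X μ) (hg : StronglyMeasurable[mG] g) (hg0 : 0 ≤ᵐ[μ] g) :
    HasGenCondExp μ mG (fun ω => g ω * X ω) (fun ω => g ω * W ω) := by
  have hgm : Measurable[mG] fun ω => ENNReal.ofReal (g ω) := hg.measurable.ennreal_ofReal
  have key : ∀ (f : ℝ → ℝ), Measurable f → (∀ c x, 0 ≤ c → f (c * x) = c * f x) →
      condLExp mG μ (fun ω => ENNReal.ofReal (f (g ω * X ω))) =ᵐ[μ]
        fun ω => ENNReal.ofReal (g ω) * condLExp mG μ (fun ω => ENNReal.ofReal (f (X ω))) ω := by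
    intro f hf hc
    refine (condLExp_congr_ae ?_).trans (condLExp_mul_left hm hgm
      (hf.comp_aemeasurable hX).ennreal_ofReal)
    filter_upwards [hg0] with ω hω
    rw [hc _ _ hω, ENNReal.ofReal_mul hω]
  have h1 := key (fun x => |x|) (by fun_prop) fun c x hc => by rw [abs_mul, abs_of_nonneg hc]
  have h2 := key (fun x => x) measurable_id fun _ _ _ => rfl
  have h3 := key (fun x => -x) (by fun_prop) fun c x _ => by ring
  refine ⟨?_, ?_⟩
  · filter_upwards [h.1, h1] with ω a b
    rw [b]
    exact ENNReal.mul_lt_top ENNReal.ofReal_lt_top a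
  · filter_upwards [h.2, h2, h3, hg0] with ω a b c d
    rw [a, b, c, ENNReal.toReal_mul, ENNReal.toReal_mul, ENNReal.toReal_ofReal d]
    ring

/-- Once a deflator is small enough for integrability, this turns the one-step identities into
ordinary martingale identities. -/
lemma HasGenCondExp.condExp_ae_eq {X W : Ω → ℝ} (h : HasGenCondExp μ mG X W)
    (hX : Integrable X μ) : μ[X | mG] =ᵐ[μ] W := by
  have h1 := toReal_condLExp mG (μ := μ) (f := fun ω => ENNReal.ofReal (X ω))
    hX.1.aemeasurable.ennreal_ofReal hX.lintegral_lt_top.ne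
  have h2 := toReal_condLExp mG (μ := μ) (f := fun ω => ENNReal.ofReal (-X ω))
    hX.neg.1.aemeasurable.ennreal_ofReal hX.neg.lintegral_lt_top.ne
  have e1 : (fun ω => (ENNReal.ofReal (X ω)).toReal) = fun ω => max (X ω) 0 := by
    ext ω; exact ENNReal.toReal_ofReal'
  have e2 : (fun ω => (ENNReal.ofReal (-X ω)).toReal) = fun ω => max (-X ω) 0 := by
    ext ω; exact ENNReal.toReal_ofReal'
  rw [e1] at h1
  rw [e2] at h2
  have h3 := condExp_sub hX.pos_part hX.neg.pos_part mG
  have e3 : ((fun ω => max (X ω) 0) - fun ω => max ((-X) ω) 0) = X := by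
    ext ω
    exact max_zero_sub_max_neg_zero_eq_self (X ω)
  rw [e3] at h3
  filter_upwards [h.2, h1, h2, h3] with ω a b c d
  rw [d, a, b, c]
  rfl

variable {S : Type*} {mS : MeasurableSpace S}

/-- `κ` is a regular conditional distribution of `Y` given `mG`. -/
def IsCondKernel (μ : Measure Ω) (mG : MeasurableSpace Ω) (Y : Ω → S) (κ : Kernel[mG, mS] Ω S) :
    Prop :=
  ∀ φ : Ω × S → ℝ≥0∞, Measurable[mG.prod mS] φ →
    condLExp mG μ (fun ω => φ (ω, Y ω)) =ᵐ[μ] fun ω => ∫⁻ y, φ (ω, y) ∂κ ω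

/-- Conditioning on `mG` is conditioning on the identity map from `(Ω, mΩ)` to `(Ω, mG)`, whose law
is `μ.trim hm`. -/
lemma exists_isCondKernel [IsFiniteMeasure μ] [StandardBorelSpace S] [Nonempty S]
    (hm : mG ≤ mΩ) {Y : Ω → S}
    (hY : Measurable Y) :
    ∃ κ : Kernel[mG, mS] Ω S, IsMarkovKernel κ ∧ IsCondKernel μ mG Y κ := by
  refine ⟨@condDistrib Ω Ω S mS _ _ mΩ mG Y id μ _, inferInstance, fun φ hφ => ?_⟩
  have hκ := @compProd_map_condDistrib Ω Ω S mS _ _ mΩ μ _ id Y mG hY.aemeasurable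
  have hmap : @Measure.map Ω Ω mΩ mG id μ = μ.trim hm := (trim_eq_map hm).symm
  rw [hmap] at hκ
  set κ := @condDistrib Ω Ω S mS _ _ mΩ mG Y id μ _
  have hI : Measurable[mG] fun ω => ∫⁻ y, φ (ω, y) ∂κ ω :=
    Measurable.lintegral_kernel_prod_right' hφ
  refine (ae_eq_condLExp hm μ _ hI fun s hs => ?_).symm
  have hYm : Measurable[mΩ, mG.prod mS] fun ω => (id ω, Y ω) :=
    (measurable_id'' hm).prodMk hY
  rw [← setLIntegral_trim hm hI hs]
  have h1 := Measure.setLIntegral_compProd (μ := μ.trim hm) (κ := κ) hφ hs MeasurableSet.univ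
  simp only [Measure.restrict_univ] at h1
  rw [← h1, hκ]
  refine (@setLIntegral_map Ω (Ω × S) mΩ (mG.prod mS) μ _ _ _
    (hs.prod MeasurableSet.univ) hφ hYm).trans ?_
  congr 2
  ext ω
  simp

lemma IsCondKernel.lintegral_eq [IsFiniteMeasure μ] (hm : mG ≤ mΩ) {Y : Ω → S}
    {κ : Kernel[mG, mS] Ω S}
    (h : IsCondKernel μ mG Y κ) {φ : Ω × S → ℝ≥0∞} (hφ : Measurable[mG.prod mS] φ) :
    ∫⁻ ω, φ (ω, Y ω) ∂μ = ∫⁻ ω, ∫⁻ y, φ (ω, y) ∂κ ω ∂μ := by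
  rw [← lintegral_condLExp hm]
  exact lintegral_congr_ae (h φ hφ)

lemma IsCondKernel.ae_iff [IsFiniteMeasure μ] (hm : mG ≤ mΩ) {Y : Ω → S} (hY : Measurable Y)
    {κ : Kernel[mG, mS] Ω S} [IsMarkovKernel κ]
    (h : IsCondKernel μ mG Y κ) {s : Set (Ω × S)} (hs : MeasurableSet[mG.prod mS] s) :
    (∀ᵐ ω ∂μ, (ω, Y ω) ∈ s) ↔ ∀ᵐ ω ∂μ, ∀ᵐ y ∂κ ω, (ω, y) ∈ s := by
  have hφ : Measurable[mG.prod mS] (sᶜ.indicator fun _ => (1 : ℝ≥0∞)) :=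
    measurable_const.indicator hs.compl
  have h1 := h.lintegral_eq hm hφ
  have hYm : Measurable[mΩ, mG.prod mS] fun ω => (ω, Y ω) := (measurable_id'' hm).prodMk hY
  have hI : Measurable[mG] fun ω => ∫⁻ y, sᶜ.indicator (fun _ => (1 : ℝ≥0∞)) (ω, y) ∂κ ω :=
    Measurable.lintegral_kernel_prod_right' hφ
  have e1 : (∀ᵐ ω ∂μ, (ω, Y ω) ∈ s) ↔
      ∫⁻ ω, sᶜ.indicator (fun _ => (1 : ℝ≥0∞)) (ω, Y ω) ∂μ = 0 := by
    rw [lintegral_eq_zero_iff (f := fun ω => sᶜ.indicator _ (ω, Y ω)) (hφ.comp hYm)]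
    refine Filter.eventually_congr (Filter.Eventually.of_forall fun ω => ?_)
    simp
  have e2 : (∀ᵐ ω ∂μ, ∀ᵐ y ∂κ ω, (ω, y) ∈ s) ↔
      ∫⁻ ω, ∫⁻ y, sᶜ.indicator (fun _ => (1 : ℝ≥0∞)) (ω, y) ∂κ ω ∂μ = 0 := by
    rw [lintegral_eq_zero_iff (hI.mono hm le_rfl)]
    refine Filter.eventually_congr (Filter.Eventually.of_forall fun ω => ?_)
    have hω : Measurable fun y : S => sᶜ.indicator (fun _ => (1 : ℝ≥0∞)) (ω, y) :=
      hφ.comp (@measurable_prodMk_left _ _ mG mS ω)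
    rw [Pi.zero_apply, lintegral_eq_zero_iff hω]
    refine Filter.eventually_congr (Filter.Eventually.of_forall fun y => ?_)
    simp
  rw [e1, e2, h1]

/-- Reduces conditional problems to deterministic ones: for each ω, an ordinary integral against `κ
ω`. -/
lemma IsCondKernel.hasGenCondExp_iff {Y : Ω → S}
    {κ : Kernel[mG, mS] Ω S} [IsMarkovKernel κ]
    (h : IsCondKernel μ mG Y κ) {φ : Ω × S → ℝ} (hφ : Measurable[mG.prod mS] φ) {W : Ω → ℝ} :
    HasGenCondExp μ mG (fun ω => φ (ω, Y ω)) W ↔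
      (∀ᵐ ω ∂μ, Integrable (fun y => φ (ω, y)) (κ ω)) ∧
      ∀ᵐ ω ∂μ, W ω = ∫ y, φ (ω, y) ∂κ ω := by
  have h1 := h (fun p => ENNReal.ofReal |φ p|) (measurable_norm.comp hφ).ennreal_ofReal
  have h2 := h (fun p => ENNReal.ofReal (φ p)) hφ.ennreal_ofReal
  have h3 := h (fun p => ENNReal.ofReal (-φ p)) hφ.neg.ennreal_ofReal
  have hω : ∀ ω, Measurable fun y : S => φ (ω, y) := fun ω =>
    hφ.comp (@measurable_prodMk_left _ _ mG mS ω)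
  have hint : ∀ ω, Integrable (fun y => φ (ω, y)) (κ ω) ↔
      ∫⁻ y, ENNReal.ofReal |φ (ω, y)| ∂κ ω < ∞ := fun ω => by
    simp only [Integrable, (hω ω).aestronglyMeasurable, true_and, hasFiniteIntegral_iff_norm,
      Real.norm_eq_abs]
  unfold HasGenCondExp
  have e1 : (∀ᵐ ω ∂μ, condLExp mG μ (fun ω' => ENNReal.ofReal |φ (ω', Y ω')|) ω < ∞) ↔
      ∀ᵐ ω ∂μ, Integrable (fun y => φ (ω, y)) (κ ω) := by
    refine Filter.eventually_congr ?_
    filter_upwards [h1] with ω a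
    rw [a, hint]
  rw [e1]
  refine and_congr_right fun hi => Filter.eventually_congr ?_
  filter_upwards [hi, h2, h3] with ω a b c
  rw [b, c, integral_eq_lintegral_pos_part_sub_lintegral_neg_part a]

end GenCondExp

/-! ### Expected disutility and its first order condition -/

section FirstOrderCondition

/-- Dominated convergence: near `h₀` the continuous `B` stays below `B h₀ + 1`, which gives a local
integrable bound. -/
lemma continuous_integral_of_abs_le_mul {E S : Type*} [NormedAddCommGroup E]
    [MeasurableSpace S] {ν : Measure S} {F : E → S → ℝ} {B : E → ℝ} {g : S → ℝ}
    (hg : Integrable g ν) (hB : Continuous B) (hm : ∀ h, Measurable (F h))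
    (hFB : ∀ h s, |F h s| ≤ B h * |g s|) (hc : ∀ s, Continuous fun h => F h s) :
    Continuous fun h => ∫ s, F h s ∂ν := by
  refine continuous_iff_continuousAt.2 fun h₀ => ?_
  refine continuousAt_of_dominated (bound := fun s => (B h₀ + 1) * |g s|)
    (Filter.Eventually.of_forall fun h => (hm h).aestronglyMeasurable) ?_
    (hg.abs.const_mul _) (Filter.Eventually.of_forall fun s => (hc s).continuousAt)
  have : ∀ᶠ h in nhds h₀, B h < B h₀ + 1 :=
    hB.continuousAt.eventually_lt continuousAt_const (by linarith)
  filter_upwards [this] with h hh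
  exact Filter.Eventually.of_forall fun s =>
    (hFB h s).trans (mul_le_mul_of_nonneg_right hh.le (abs_nonneg _))

lemma continuous_integral_of_abs_le {E S : Type*} [NormedAddCommGroup E]
    [MeasurableSpace S] {ν : Measure S} [IsFiniteMeasure ν] {F : E → S → ℝ} {B : E → ℝ}
    (hB : Continuous B) (hm : ∀ h, Measurable (F h)) (hFB : ∀ h s, |F h s| ≤ B h)
    (hc : ∀ s, Continuous fun h => F h s) : Continuous fun h => ∫ s, F h s ∂ν :=
  continuous_integral_of_abs_le_mul (integrable_const (1 : ℝ)) hB hm (by simpa using hFB) hc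

lemma integrable_of_abs_le {S : Type*} [MeasurableSpace S] {ν : Measure S} [IsFiniteMeasure ν]
    {f : S → ℝ} {c : ℝ} (hf : Measurable f) (h : ∀ s, |f s| ≤ c) : Integrable f ν :=
  Integrable.of_bound hf.aestronglyMeasurable c (Filter.Eventually.of_forall h)

/-- The function `1 - x / √(1 + x²)`, minus the derivative of `√(1 + x²) - x`. -/
noncomputable def marginal (x : ℝ) : ℝ := 1 - x / √(1 + x ^ 2)

lemma abs_lt_sqrt_one_add_sq (x : ℝ) : |x| < √(1 + x ^ 2) :=
  Real.lt_sqrt_of_sq_lt (by rw [sq_abs]; linarith)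

lemma abs_div_sqrt_lt_one (x : ℝ) : |x / √(1 + x ^ 2)| < 1 := by
  have h := abs_lt_sqrt_one_add_sq x
  have h0 := (abs_nonneg x).trans_lt h
  rw [abs_div, abs_of_pos h0, div_lt_one h0]
  exact h

lemma marginal_pos (x : ℝ) : 0 < marginal x := by
  have := (abs_lt.1 (abs_div_sqrt_lt_one x)).2
  unfold marginal; linarith

lemma marginal_le_two (x : ℝ) : marginal x ≤ 2 := by
  have := (abs_lt.1 (abs_div_sqrt_lt_one x)).1
  unfold marginal; linarith

lemma abs_marginal_le_two (x : ℝ) : |marginal x| ≤ 2 := by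
  rw [abs_of_pos (marginal_pos x)]
  exact marginal_le_two x

lemma continuous_marginal : Continuous marginal := by
  have : ∀ x : ℝ, √(1 + x ^ 2) ≠ 0 := fun x => by positivity
  unfold marginal
  fun_prop (disch := assumption)

lemma hasDerivAt_sqrt_one_add_sq_sub (x : ℝ) :
    HasDerivAt (fun x : ℝ => √(1 + x ^ 2) - x) (-marginal x) x := by
  have h : HasDerivAt (fun x : ℝ => 1 + x ^ 2) (2 * x) x := by
    simpa using (hasDerivAt_pow 2 x).const_add 1
  refine ((h.sqrt (by positivity)).sub (hasDerivAt_id' x)).congr_deriv ?_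
  unfold marginal
  rw [mul_div_mul_left _ _ two_ne_zero]
  ring

variable {n : ℕ} {S : Type*} [MeasurableSpace S] {ν : Measure S} [IsFiniteMeasure ν]
  {r : S → Fin n → ℝ}

lemma abs_dotProduct_le_sum (h : Fin n → ℝ) {q : Fin n → ℝ} (hq : ∀ i, |q i| ≤ 1) :
    |h ⬝ᵥ q| ≤ ∑ i, |h i| := by
  refine (Finset.abs_sum_le_sum_abs _ _).trans (Finset.sum_le_sum fun i _ => ?_)
  rw [abs_mul]
  exact mul_le_of_le_one_right (abs_nonneg _) (hq i)

lemma measurable_dotProduct {S : Type*} {mS : MeasurableSpace S} {r h : S → Fin n → ℝ}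
    (hh : Measurable h) (hr : Measurable r) : Measurable fun s => h s ⬝ᵥ r s :=
  Finset.measurable_fun_sum _ fun i _ =>
    ((measurable_pi_apply i).comp hh).mul ((measurable_pi_apply i).comp hr)

lemma continuous_dotProduct_left (q : Fin n → ℝ) : Continuous fun h : Fin n → ℝ => h ⬝ᵥ q :=
  continuous_finsetSum _ fun i _ => (continuous_apply i).mul continuous_const

/-- In the absence of arbitrage, the expected disutility `∫ √(1 + (h · r)²) - h · r` attains its
minimum, and the first order condition holds there. -/
lemma exists_integral_marginal_eq_zero (hr : Measurable r) (hr1 : ∀ s i, |r s i| ≤ 1)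
    (hNA : ∀ h : Fin n → ℝ, (∀ᵐ s ∂ν, 0 ≤ h ⬝ᵥ r s) → ∀ᵐ s ∂ν, h ⬝ᵥ r s = 0) :
    ∃ h : Fin n → ℝ, ∀ i, ∫ s, r s i * marginal (h ⬝ᵥ r s) ∂ν = 0 := by
  have hdot : ∀ h : Fin n → ℝ, Measurable fun s => h ⬝ᵥ r s := fun h =>
    measurable_dotProduct measurable_const hr
  have hri : ∀ i, Measurable fun s => r s i := fun i => (measurable_pi_apply i).comp hr
  have hsum : Continuous fun h : Fin n → ℝ => ∑ i, |h i| := by fun_prop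
  set ψ : ℝ → ℝ := fun x => √(1 + x ^ 2) - x with hψ
  have hψc : Continuous ψ := by fun_prop
  have hψ0 : ∀ x, max (-x) 0 ≤ ψ x := fun x => by
    have := abs_lt_sqrt_one_add_sq x
    have := abs_lt.1 this
    refine max_le ?_ ?_ <;> simp only [hψ]
    · linarith [Real.sqrt_nonneg (1 + x ^ 2)]
    · linarith
  have hψB : ∀ x b, |x| ≤ b → |ψ x| ≤ 1 + 2 * b := fun x b hb => by
    rw [abs_of_nonneg ((le_max_right _ _).trans (hψ0 x))]
    have : √(1 + x ^ 2) ≤ 1 + |x| := by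
      refine Real.sqrt_le_iff.2 ⟨by positivity, ?_⟩
      nlinarith [abs_nonneg x, sq_abs x]
    simp only [hψ]
    linarith [neg_abs_le x]
  -- `g` is a positively homogeneous minorant of `f`, the expected loss; it supplies the coercivity
  -- of `f`.
  set f : (Fin n → ℝ) → ℝ := fun h => ∫ s, ψ (h ⬝ᵥ r s) ∂ν with hf
  set g : (Fin n → ℝ) → ℝ := fun h => ∫ s, max (-(h ⬝ᵥ r s)) 0 ∂ν with hg
  have hfB : ∀ h s, |ψ (h ⬝ᵥ r s)| ≤ 1 + 2 * ∑ i, |h i| := fun h s =>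
    hψB _ _ (abs_dotProduct_le_sum h (hr1 s))
  have hgB : ∀ h s, |max (-(h ⬝ᵥ r s)) 0| ≤ ∑ i, |h i| := fun h s => by
    rw [abs_of_nonneg (le_max_right _ _)]
    exact max_le ((neg_le_abs _).trans (abs_dotProduct_le_sum h (hr1 s)))
      (Finset.sum_nonneg fun _ _ => abs_nonneg _)
  have hfm : ∀ h, Measurable fun s => ψ (h ⬝ᵥ r s) := fun h => hψc.measurable.comp (hdot h)
  have hgm : ∀ h, Measurable fun s => max (-(h ⬝ᵥ r s)) 0 := fun h =>
    (hdot h).neg.max measurable_const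
  have hfc : Continuous f := continuous_integral_of_abs_le (by fun_prop) hfm hfB fun s =>
    hψc.comp (continuous_dotProduct_left _)
  have hgc : Continuous g := continuous_integral_of_abs_le hsum hgm hgB fun s =>
    (continuous_dotProduct_left _).neg.max continuous_const
  have hgf : ∀ h, g h ≤ f h := fun h => integral_mono (integrable_of_abs_le (hgm h) (hgB h))
    (integrable_of_abs_le (hfm h) (hfB h)) fun s => hψ0 _
  have hg0 : ∀ h, 0 ≤ g h := fun h => integral_nonneg fun s => le_max_right _ _
  -- The redundant directions: `f` is invariant under `V`, so it suffices to minimise on a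
  -- complement.
  let V : Submodule ℝ (Fin n → ℝ) :=
    { carrier := {h | ∀ᵐ s ∂ν, h ⬝ᵥ r s = 0}
      add_mem' := fun {a b} ha hb => by
        change ∀ᵐ s ∂ν, (a + b) ⬝ᵥ r s = 0
        filter_upwards [ha, hb] with s h1 h2
        rw [add_dotProduct, h1, h2, add_zero]
      zero_mem' := by simp
      smul_mem' := fun c a ha => by
        change ∀ᵐ s ∂ν, (c • a) ⬝ᵥ r s = 0
        filter_upwards [ha] with s h1
        rw [smul_dotProduct, h1, smul_zero] }
  have hgV : ∀ h, g h = 0 → h ∈ V := fun h hh => by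
    refine hNA h ?_
    have := (integral_eq_zero_iff_of_nonneg (fun s => le_max_right _ _)
      (integrable_of_abs_le (hgm h) (hgB h))).1 hh
    filter_upwards [this] with s hs
    have := le_max_left (-(h ⬝ᵥ r s)) 0
    simp only [Pi.zero_apply] at hs
    linarith
  obtain ⟨C, hC⟩ := V.exists_isCompl
  have hCc : IsClosed (C : Set (Fin n → ℝ)) := C.closed_of_finiteDimensional
  -- By `hNA`, `g` vanishes only on `V`, so its minimum on the compact unit sphere of `C` is
  -- positive; homogeneity extends the bound.
  have hcoer : ∃ c > 0, ∀ h ∈ C, c * ‖h‖ ≤ g h := by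
    have hK : IsCompact (Metric.sphere (0 : Fin n → ℝ) 1 ∩ C) :=
      (isCompact_sphere _ _).inter_right hCc
    rcases (Metric.sphere (0 : Fin n → ℝ) 1 ∩ C).eq_empty_or_nonempty with he | hne
    · refine ⟨1, one_pos, fun h hh => ?_⟩
      have : h = 0 := by
        by_contra h0
        refine (Set.eq_empty_iff_forall_notMem.1 he) (‖h‖⁻¹ • h) ⟨?_, C.smul_mem _ hh⟩
        simp [norm_smul, norm_ne_zero_iff.2 h0]
      rw [this, norm_zero, mul_zero]
      exact hg0 0
    · obtain ⟨u, ⟨hu1, huC⟩, humin⟩ := hK.exists_isMinOn hne hgc.continuousOn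
      refine ⟨g u, lt_of_le_of_ne (hg0 u) fun h0 => ?_, fun h hh => ?_⟩
      · have : u ∈ V ⊓ C := ⟨hgV u h0.symm, huC⟩
        rw [hC.inf_eq_bot, Submodule.mem_bot] at this
        simp [this] at hu1
      · rcases eq_or_ne h 0 with rfl | h0
        · simpa using hg0 0
        · have hn : 0 < ‖h‖ := norm_pos_iff.2 h0
          have h1 : g u ≤ g (‖h‖⁻¹ • h) :=
            humin ⟨by simp [norm_smul, hn.ne'], C.smul_mem _ hh⟩
          have h2 : g (‖h‖⁻¹ • h) = ‖h‖⁻¹ * g h := by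
            simp only [hg]
            rw [← integral_const_mul]
            refine integral_congr_ae (Filter.Eventually.of_forall fun s => ?_)
            simp only [smul_dotProduct, smul_eq_mul]
            rw [mul_max_of_nonneg _ _ (inv_nonneg.2 hn.le), mul_neg, mul_zero]
          rw [h2] at h1
          calc g u * ‖h‖ ≤ ‖h‖⁻¹ * g h * ‖h‖ := by gcongr
            _ = g h := by field_simp
  obtain ⟨c, hc0, hc⟩ := hcoer
  -- In `C` and beyond the radius `f 0 / c`, one has `f ≥ g > f 0`, so a minimum over the ball is a
  -- minimum over `C`.
  obtain ⟨h, hhK, hmin⟩ := ((isCompact_closedBall (0 : Fin n → ℝ) (f 0 / c)).inter_right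
    hCc).exists_isMinOn ⟨0, by
      simpa using div_nonneg ((hg0 0).trans (hgf 0)) hc0.le, C.zero_mem⟩ hfc.continuousOn
  have hminC : ∀ x ∈ C, f h ≤ f x := fun x hx => by
    by_cases hxb : ‖x‖ ≤ f 0 / c
    · exact hmin ⟨by simpa using hxb, hx⟩
    · have h1 : f h ≤ f 0 := hmin ⟨by
        simpa using div_nonneg ((hg0 0).trans (hgf 0)) hc0.le, C.zero_mem⟩
      have h2 : f 0 < c * ‖x‖ := by
        rw [mul_comm]; exact (div_lt_iff₀ hc0).1 (not_le.1 hxb)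
      linarith [hc x hx, hgf x]
  have hminE : ∀ x, f h ≤ f x := fun x => by
    have hx : x ∈ V ⊔ C := by rw [hC.sup_eq_top]; trivial
    obtain ⟨v, hv, y, hy, rfl⟩ := Submodule.mem_sup.1 hx
    refine (hminC y hy).trans_eq (integral_congr_ae ?_)
    filter_upwards [hv] with s hs
    rw [add_dotProduct, hs, zero_add]
  refine ⟨h, fun i => ?_⟩
  have hlin : ∀ (t : ℝ) s, (h + t • Pi.single i 1) ⬝ᵥ r s = h ⬝ᵥ r s + t * r s i := fun t s => by
    rw [add_dotProduct, smul_dotProduct, single_dotProduct, one_mul, smul_eq_mul]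
  have hderiv := hasDerivAt_integral_of_dominated_loc_of_deriv_le (μ := ν) (x₀ := (0 : ℝ))
    (F := fun t s => ψ (h ⬝ᵥ r s + t * r s i))
    (F' := fun t s => -marginal (h ⬝ᵥ r s + t * r s i) * r s i) (bound := fun _ => 2)
    Filter.univ_mem
    (Filter.Eventually.of_forall fun t =>
      (hψc.measurable.comp ((hdot h).add ((hri i).const_mul t))).aestronglyMeasurable)
    (by simpa using integrable_of_abs_le (hfm h) (hfB h))
    (((continuous_marginal.measurable.comp
      ((hdot h).add ((hri i).const_mul 0))).neg.mul (hri i)).aestronglyMeasurable)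
    (Filter.Eventually.of_forall fun s t _ => by
      rw [norm_mul, norm_neg, Real.norm_eq_abs, Real.norm_eq_abs]
      exact (mul_le_mul (abs_marginal_le_two _) (hr1 s i) (abs_nonneg _) zero_le_two).trans_eq
        (mul_one 2))
    (integrable_const _)
    (Filter.Eventually.of_forall fun s t _ => by
      have h1 : HasDerivAt (fun t : ℝ => h ⬝ᵥ r s + t * r s i) (r s i) t := by
        simpa using ((hasDerivAt_id' t).mul_const (r s i)).const_add (h ⬝ᵥ r s)
      exact (hasDerivAt_sqrt_one_add_sq_sub _).comp t h1)
  have hloc : IsLocalMin (fun t : ℝ => ∫ s, ψ (h ⬝ᵥ r s + t * r s i) ∂ν) 0 := by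
    refine Filter.Eventually.of_forall fun t => ?_
    have := hminE (h + t • Pi.single i 1)
    simp only [hf, hlin] at this
    simpa using this
  have h0 := hloc.hasDerivAt_eq_zero hderiv.2
  simp only [zero_mul, add_zero, neg_mul, integral_neg, neg_eq_zero] at h0
  rw [← h0]
  simp only [mul_comm]

end FirstOrderCondition

/-! ### Measurable choice of portfolios for a kernel -/

section OneStep

variable {n : ℕ} {α S : Type*} [MeasurableSpace α] [MeasurableSpace S] {η : Kernel α S}
  [IsFiniteKernel η] {r : S → Fin n → ℝ}

/-- Measurable selection of directions `h` with `h · r ≥ 0`, non-trivial for at least one index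
whenever a non-trivial direction exists. -/
lemma exists_measurable_arbitrage (hr : Measurable r) (hr1 : ∀ s i, |r s i| ≤ 1) :
    ∃ y : ℕ → α → Fin n → ℝ, (∀ k, Measurable (y k)) ∧
      (∀ k a, ∀ᵐ s ∂η a, 0 ≤ y k a ⬝ᵥ r s) ∧
      ∀ a, (∀ k, ∀ᵐ s ∂η a, y k a ⬝ᵥ r s = 0) →
        ∀ h : Fin n → ℝ, (∀ᵐ s ∂η a, 0 ≤ h ⬝ᵥ r s) → ∀ᵐ s ∂η a, h ⬝ᵥ r s = 0 := by
  have hdot : ∀ h : Fin n → ℝ, Measurable fun s => h ⬝ᵥ r s := fun h =>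
    measurable_dotProduct measurable_const hr
  have hsum : Continuous fun h : Fin n → ℝ => ∑ i, |h i| := by fun_prop
  have hAm : ∀ h : Fin n → ℝ, Measurable fun s => max (-(h ⬝ᵥ r s)) 0 := fun h =>
    (hdot h).neg.max measurable_const
  have hBm : ∀ h : Fin n → ℝ, Measurable fun s => |h ⬝ᵥ r s| := fun h =>
    measurable_norm.comp (hdot h)
  have hAB : ∀ h s, |max (-(h ⬝ᵥ r s)) 0| ≤ ∑ i, |h i| := fun h s => by
    rw [abs_of_nonneg (le_max_right _ _)]
    exact max_le ((neg_le_abs _).trans (abs_dotProduct_le_sum h (hr1 s)))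
      (Finset.sum_nonneg fun _ _ => abs_nonneg _)
  have hBB : ∀ (h : Fin n → ℝ) s, |(|h ⬝ᵥ r s|)| ≤ ∑ i, |h i| := fun h s => by
    rw [abs_abs]; exact abs_dotProduct_le_sum h (hr1 s)
  set A : α → (Fin n → ℝ) → ℝ := fun a h => ∫ s, max (-(h ⬝ᵥ r s)) 0 ∂η a with hA
  set B : α → (Fin n → ℝ) → ℝ := fun a h => ∫ s, |h ⬝ᵥ r s| ∂η a with hB
  have hAc : ∀ a, Continuous (A a) := fun a =>
    continuous_integral_of_abs_le hsum hAm hAB fun s =>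
      (continuous_dotProduct_left _).neg.max continuous_const
  have hBc : ∀ a, Continuous (B a) := fun a =>
    continuous_integral_of_abs_le hsum hBm hBB fun s => (continuous_dotProduct_left _).abs
  have hA0 : ∀ a h, 0 ≤ A a h := fun a h => integral_nonneg fun s => le_max_right _ _
  have hAzero : ∀ a h, A a h = 0 ↔ ∀ᵐ s ∂η a, 0 ≤ h ⬝ᵥ r s := fun a h => by
    refine (integral_eq_zero_iff_of_nonneg (f := fun s => max (-(h ⬝ᵥ r s)) 0)
      (fun s => le_max_right _ _) (integrable_of_abs_le (hAm h) (hAB h))).trans ?_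
    refine Filter.eventually_congr (Filter.Eventually.of_forall fun s => ?_)
    simp
  have hBzero : ∀ a h, B a h = 0 ↔ ∀ᵐ s ∂η a, h ⬝ᵥ r s = 0 := fun a h => by
    refine (integral_eq_zero_iff_of_nonneg (f := fun s => |h ⬝ᵥ r s|)
      (fun s => abs_nonneg _) (integrable_of_abs_le (hBm h) (hBB h))).trans ?_
    refine Filter.eventually_congr (Filter.Eventually.of_forall fun s => ?_)
    simp
  -- Non-triviality `B a h > 0` is not a closed condition; splitting it into `B a h ≥ 1 / (k + 1)`
  -- makes each piece the zero set of a continuous function.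
  set G : ℕ → α → (Fin n → ℝ) → ℝ :=
    fun k a h => A a h + max (1 / ((k : ℝ) + 1) - B a h) 0 with hG
  have hGm : ∀ k (z : α → Fin n → ℝ), Measurable z → Measurable fun a => G k a (z a) := by
    intro k z hz
    have hzr : Measurable fun p : α × S => z p.1 ⬝ᵥ r p.2 :=
      measurable_dotProduct (hz.comp measurable_fst) (hr.comp measurable_snd)
    have h1 : Measurable fun a => A a (z a) :=
      (StronglyMeasurable.integral_kernel_prod_right' (κ := η)
        (hzr.neg.max measurable_const).stronglyMeasurable).measurable
    have h2 : Measurable fun a => B a (z a) :=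
      (StronglyMeasurable.integral_kernel_prod_right' (κ := η)
        (measurable_norm.comp hzr).stronglyMeasurable).measurable
    exact h1.add ((measurable_const.sub h2).max measurable_const)
  have hG0 : ∀ k a h, 0 ≤ G k a h := fun k a h => add_nonneg (hA0 a h) (le_max_right _ _)
  have hGzero : ∀ k a h, G k a h = 0 ↔ A a h = 0 ∧ 1 / ((k : ℝ) + 1) ≤ B a h := fun k a h => by
    rw [hG, add_eq_zero_iff_of_nonneg (hA0 a h) (le_max_right _ _)]
    simp
  choose z hz hz' using fun k => exists_measurable_zero (G := G k)
    (fun h => hGm k _ measurable_const)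
    (fun a => (hAc a).add ((continuous_const.sub (hBc a)).max continuous_const)) (hG0 k)
  have hSm : ∀ k, MeasurableSet {a | G k a (z k a) = 0} := fun k =>
    hGm k _ (hz k) (measurableSet_singleton 0)
  -- Where the selection found no zero, the direction 0 satisfies the inequality trivially.
  refine ⟨fun k => Set.indicator {a | G k a (z k a) = 0} (z k),
    fun k => (hz k).indicator (hSm k), fun k a => ?_, fun a ha h hh => ?_⟩
  · by_cases hk : G k a (z k a) = 0
    · beta_reduce
      rw [Set.indicator_of_mem (by exact hk)]
      exact (hAzero _ _).1 ((hGzero _ _ _).1 hk).1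
    · beta_reduce
      rw [Set.indicator_of_notMem (by exact hk)]
      simp
  · by_contra hne
    have hBp : 0 < B a h := lt_of_le_of_ne (integral_nonneg fun s => abs_nonneg _)
      fun h0 => hne ((hBzero _ _).1 h0.symm)
    obtain ⟨k, hk⟩ := exists_nat_one_div_lt hBp
    have hk0 : G k a (z k a) = 0 := hz' k a ⟨h, (hGzero _ _ _).2 ⟨(hAzero _ _).2 hh, hk.le⟩⟩
    have h1 := ha k
    beta_reduce at h1
    rw [Set.indicator_of_mem (by exact hk0)] at h1
    have h2 := ((hGzero _ _ _).1 hk0).2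
    rw [(hBzero _ _).2 h1] at h2
    exact absurd h2 (not_le.2 (by positivity))

/-- The first order condition says that a continuous function of `h` has a zero, so its solution can
be selected measurably. -/
lemma exists_measurable_integral_marginal_eq_zero (hr : Measurable r)
    (hr1 : ∀ s i, |r s i| ≤ 1) :
    ∃ y : α → Fin n → ℝ, Measurable y ∧ ∀ a,
      (∀ h : Fin n → ℝ, (∀ᵐ s ∂η a, 0 ≤ h ⬝ᵥ r s) → ∀ᵐ s ∂η a, h ⬝ᵥ r s = 0) →
      ∀ i, ∫ s, r s i * marginal (y a ⬝ᵥ r s) ∂η a = 0 := by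
  have hri : ∀ i, Measurable fun s => r s i := fun i => (measurable_pi_apply i).comp hr
  have hm : ∀ (h : Fin n → ℝ) i, Measurable fun s => r s i * marginal (h ⬝ᵥ r s) := fun h i =>
    (hri i).mul (continuous_marginal.measurable.comp (measurable_dotProduct measurable_const hr))
  have hB : ∀ (h : Fin n → ℝ) i s, |r s i * marginal (h ⬝ᵥ r s)| ≤ 2 := fun h i s => by
    rw [abs_mul]
    exact (mul_le_mul (hr1 s i) (abs_marginal_le_two _) (abs_nonneg _) zero_le_one).trans_eq
      (one_mul 2)
  have hsum : ∀ a (h : Fin n → ℝ), ∑ i, |∫ s, r s i * marginal (h ⬝ᵥ r s) ∂η a| = 0 ↔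
      ∀ i, ∫ s, r s i * marginal (h ⬝ᵥ r s) ∂η a = 0 := fun a h => by
    rw [Finset.sum_eq_zero_iff_of_nonneg fun _ _ => abs_nonneg _]
    simp
  obtain ⟨y, hy, hy'⟩ := exists_measurable_zero
    (G := fun a (h : Fin n → ℝ) => ∑ i, |∫ s, r s i * marginal (h ⬝ᵥ r s) ∂η a|)
    (fun h => Finset.measurable_fun_sum _ fun i _ => measurable_norm.comp
      (StronglyMeasurable.integral_kernel (κ := η) (hm h i).stronglyMeasurable).measurable)
    (fun a => continuous_finsetSum _ fun i _ => Continuous.abs <|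
      continuous_integral_of_abs_le continuous_const (fun h => hm h i) (fun h s => hB h i s)
        fun s => continuous_const.mul (continuous_marginal.comp (continuous_dotProduct_left _)))
    fun a h => Finset.sum_nonneg fun _ _ => abs_nonneg _
  refine ⟨y, hy, fun a ha => (hsum a (y a)).1 (hy' a ?_)⟩
  obtain ⟨h, hh⟩ := exists_integral_marginal_eq_zero hr hr1 ha
  exact ⟨h, (hsum a h).2 hh⟩

end OneStep

/-! ### The one-period market -/

section OneStepMarket

variable {n : ℕ} {Ω : Type*} {mG mΩ : MeasurableSpace Ω} {μ : Measure Ω}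

/-- Absence of arbitrage in a one-period market with prices `P₀` and `P₁`. -/
def OneStepNA (μ : Measure Ω) (mG : MeasurableSpace Ω) (P₀ P₁ : Ω → Fin n → ℝ) : Prop :=
  ∀ h : Ω → Fin n → ℝ, Measurable[mG] h → (∀ᵐ ω ∂μ, h ω ⬝ᵥ P₀ ω ≤ 0) →
    (∀ᵐ ω ∂μ, 0 ≤ h ω ⬝ᵥ P₁ ω) → (∀ᵐ ω ∂μ, h ω ⬝ᵥ P₀ ω = 0) ∧ ∀ᵐ ω ∂μ, h ω ⬝ᵥ P₁ ω = 0

/-- Rescaling of a vector into the unit cube. -/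
noncomputable def squash (q : Fin n → ℝ) : Fin n → ℝ := (1 + ‖q‖)⁻¹ • q

lemma measurable_squash : Measurable (squash : (Fin n → ℝ) → Fin n → ℝ) := by
  unfold squash; fun_prop

lemma abs_squash_le_one (q : Fin n → ℝ) (i : Fin n) : |squash q i| ≤ 1 := by
  have h := norm_le_pi_norm q i
  rw [Real.norm_eq_abs] at h
  simp only [squash, Pi.smul_apply, smul_eq_mul, abs_mul]
  rw [abs_of_nonneg (by positivity), inv_mul_le_iff₀ (by positivity)]
  linarith

lemma dotProduct_squash (h q : Fin n → ℝ) : h ⬝ᵥ squash q = (1 + ‖q‖)⁻¹ * (h ⬝ᵥ q) := by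
  rw [squash, dotProduct_smul, smul_eq_mul]

lemma dotProduct_squash_nonneg {h q : Fin n → ℝ} : 0 ≤ h ⬝ᵥ squash q ↔ 0 ≤ h ⬝ᵥ q := by
  rw [dotProduct_squash]
  exact mul_nonneg_iff_of_pos_left (by positivity)

lemma dotProduct_squash_eq_zero {h q : Fin n → ℝ} : h ⬝ᵥ squash q = 0 ↔ h ⬝ᵥ q = 0 := by
  rw [dotProduct_squash]
  exact mul_eq_zero_iff_left (by positivity)

/-- The first order condition for the conditional law of `ζ • P₁` plus an atom at `-P₀`, solved for
`P₀`. The weight found there is bounded, hence the domination of `Z` by a multiple of `ζ`. -/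
lemma OneStepNA.exists_hasGenCondExp [IsFiniteMeasure μ] {mF : MeasurableSpace Ω} (hGF : mG ≤ mF)
    (hF : mF ≤ mΩ) {P₀ P₁ : Ω → Fin n → ℝ} (hP₀ : Measurable[mG] P₀) (hP₁ : Measurable[mF] P₁)
    (hNA : OneStepNA μ mG P₀ P₁) {ζ : Ω → ℝ} (hζ : Measurable[mF] ζ) (hζ0 : ∀ᵐ ω ∂μ, 0 < ζ ω) :
    ∃ Z R : Ω → ℝ, Measurable[mF] Z ∧ (∀ᵐ ω ∂μ, 0 < Z ω) ∧
      Measurable[mG] R ∧ (∀ᵐ ω ∂μ, 0 < R ω) ∧ (∀ᵐ ω ∂μ, Z ω ≤ R ω * ζ ω) ∧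
      ∀ i, HasGenCondExp μ mG (fun ω => P₁ ω i * Z ω) (fun ω => P₀ ω i) := by
  have hm : mG ≤ mΩ := hGF.trans hF
  have hYF : Measurable[mF] fun ω => ζ ω • P₁ ω := hζ.smul hP₁
  set Y : Ω → Fin n → ℝ := fun ω => ζ ω • P₁ ω with hYdef
  have hY : Measurable[mΩ] Y := hYF.mono hF le_rfl
  obtain ⟨κ, hκM, hκ⟩ := exists_isCondKernel (μ := μ) hm hY
  have hnP₀ : Measurable[mG] fun ω => -P₀ ω := hP₀.neg
  -- The atom encodes the initial cost: `h · (-P₀) ≥ 0` says that `h` costs nothing, so both market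
  -- inequalities become one condition on `η`.
  set η : Kernel[mG, MeasurableSpace.pi] Ω (Fin n → ℝ) :=
    κ + @Kernel.deterministic _ _ mG _ (fun ω => -P₀ ω) hnP₀ with hη
  have hηae : ∀ ω (p : (Fin n → ℝ) → Prop), MeasurableSet {q | p q} →
      ((∀ᵐ q ∂η ω, p q) ↔ (∀ᵐ q ∂κ ω, p q) ∧ p (-P₀ ω)) := fun ω p hp => by
    rw [hη, add_apply, Kernel.deterministic_apply, ae_add_measure_iff, ae_dirac_iff hp]
  have hdotm : ∀ h : Fin n → ℝ, Measurable fun q : Fin n → ℝ => h ⬝ᵥ squash q := fun h =>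
    measurable_dotProduct measurable_const measurable_squash
  have hnn : ∀ h : Fin n → ℝ, MeasurableSet {q : Fin n → ℝ | 0 ≤ h ⬝ᵥ squash q} := fun h =>
    measurableSet_le measurable_const (hdotm h)
  have hzz : ∀ h : Fin n → ℝ, MeasurableSet {q : Fin n → ℝ | h ⬝ᵥ squash q = 0} := fun h =>
    hdotm h (measurableSet_singleton 0)
  have hjoint : ∀ z : Ω → Fin n → ℝ, Measurable[mG] z →
      Measurable[mG.prod MeasurableSpace.pi]
        fun p : Ω × (Fin n → ℝ) => z p.1 ⬝ᵥ squash p.2 := fun z hz =>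
    measurable_dotProduct
      (hz.comp (@measurable_fst _ _ mG _))
      (measurable_squash.comp (@measurable_snd _ _ mG _))
  obtain ⟨y, hym, hy0, hy⟩ := @exists_measurable_arbitrage n Ω _ mG _ η inferInstance squash
    measurable_squash abs_squash_le_one
  -- The uncountably many `h` are handled through the selected `y k`: each is an admissible
  -- portfolio, hence trivial by `hNA`, and triviality of all of them excludes every other
  -- direction.
  have hNAω : ∀ᵐ ω ∂μ, ∀ h : Fin n → ℝ, (∀ᵐ q ∂η ω, 0 ≤ h ⬝ᵥ squash q) →
      ∀ᵐ q ∂η ω, h ⬝ᵥ squash q = 0 := by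
    have hall : ∀ k, ∀ᵐ ω ∂μ, ∀ᵐ q ∂η ω, y k ω ⬝ᵥ squash q = 0 := by
      intro k
      have h1 := fun ω => (hηae ω _ (hnn (y k ω))).1 (hy0 k ω)
      have h2 : ∀ᵐ ω ∂μ, 0 ≤ y k ω ⬝ᵥ squash (Y ω) :=
        (hκ.ae_iff hm hY (s := {p | 0 ≤ y k p.1 ⬝ᵥ squash p.2})
          (hjoint _ (hym k) measurableSet_Ici)).2 (Filter.Eventually.of_forall fun ω => (h1 ω).1)
      obtain ⟨h3, h4⟩ := hNA (y k) (hym k)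
        (Filter.Eventually.of_forall fun ω => by
          have := dotProduct_squash_nonneg.1 (h1 ω).2
          rw [dotProduct_neg] at this
          linarith)
        (by
          filter_upwards [h2, hζ0] with ω a b
          rw [dotProduct_squash_nonneg, hYdef, dotProduct_smul, smul_eq_mul] at a
          exact (mul_nonneg_iff_of_pos_left b).1 a)
      have h5 : ∀ᵐ ω ∂μ, ∀ᵐ q ∂κ ω, y k ω ⬝ᵥ squash q = 0 :=
        (hκ.ae_iff hm hY (s := {p | y k p.1 ⬝ᵥ squash p.2 = 0})
          (hjoint _ (hym k) (measurableSet_singleton 0))).1 (by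
            filter_upwards [h4] with ω a
            rw [dotProduct_squash_eq_zero, hYdef, dotProduct_smul, a, smul_zero])
      filter_upwards [h3, h5] with ω a b
      refine (hηae ω _ (hzz _)).2 ⟨b, ?_⟩
      rw [dotProduct_squash_eq_zero, dotProduct_neg, a, neg_zero]
    filter_upwards [ae_all_iff.2 hall] with ω hω using hy ω hω
  obtain ⟨h, hhm, hh⟩ := @exists_measurable_integral_marginal_eq_zero n Ω _ mG _ η inferInstance
    squash measurable_squash abs_squash_le_one
  -- The reciprocal of the weight which the first order condition puts on `P₀` at the atom.
  set c : Ω → ℝ := fun ω =>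
    (1 + ‖-P₀ ω‖) * (marginal (h ω ⬝ᵥ squash (-P₀ ω)))⁻¹ with hc
  have hcm : Measurable[mG] c := by
    have h1 : Measurable[mG] fun ω => h ω ⬝ᵥ squash (-P₀ ω) :=
      measurable_dotProduct hhm (measurable_squash.comp hnP₀)
    exact (measurable_const.add (measurable_norm.comp hnP₀)).mul
      (continuous_marginal.measurable.comp h1).inv
  have hc0 : ∀ ω, 0 < c ω := fun ω =>
    mul_pos (by positivity) (inv_pos.2 (marginal_pos _))
  set Z : Ω → ℝ := fun ω => c ω * (ζ ω * ((1 + ‖Y ω‖)⁻¹ * marginal (h ω ⬝ᵥ squash (Y ω)))) with hZ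
  have hφm : ∀ i, Measurable[mG.prod MeasurableSpace.pi]
      fun p : Ω × (Fin n → ℝ) => squash p.2 i * marginal (h p.1 ⬝ᵥ squash p.2) := fun i =>
    (((measurable_pi_apply i).comp measurable_squash).comp (@measurable_snd _ _ mG _)).mul
      (continuous_marginal.measurable.comp (hjoint h hhm))
  have hint : ∀ i (x : Fin n → ℝ) (ν : Measure (Fin n → ℝ)) [IsFiniteMeasure ν],
      Integrable (fun q => squash q i * marginal (x ⬝ᵥ squash q)) ν := fun i x ν _ =>
    integrable_of_abs_le (c := 2) (((measurable_pi_apply i).comp measurable_squash).mul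
      (continuous_marginal.measurable.comp (hdotm x))) fun q => by
      rw [abs_mul]
      exact (mul_le_mul (abs_squash_le_one q i) (abs_marginal_le_two _) (abs_nonneg _)
        zero_le_one).trans_eq (one_mul 2)
  have hgen : ∀ i, HasGenCondExp μ mG
      (fun ω => squash (Y ω) i * marginal (h ω ⬝ᵥ squash (Y ω)))
      fun ω => (1 + ‖-P₀ ω‖)⁻¹ * P₀ ω i * marginal (h ω ⬝ᵥ squash (-P₀ ω)) := by
    intro i
    refine (hκ.hasGenCondExp_iff (φ := fun p => squash p.2 i * marginal (h p.1 ⬝ᵥ squash p.2))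
      (hφm i)).2
      ⟨Filter.Eventually.of_forall fun ω => hint i (h ω) (κ ω), ?_⟩
    filter_upwards [hNAω] with ω hω
    have h0 := hh ω hω i
    rw [hη, add_apply, Kernel.deterministic_apply,
      integral_add_measure (hint i (h ω) _) (hint i (h ω) _), integral_dirac] at h0
    rw [eq_neg_of_add_eq_zero_left h0]
    simp only [squash, Pi.smul_apply, Pi.neg_apply, smul_eq_mul]
    ring
  have hYmF : Measurable[mF] fun ω => marginal (h ω ⬝ᵥ squash (Y ω)) :=
    continuous_marginal.measurable.comp
      (measurable_dotProduct (hhm.mono hGF le_rfl) (measurable_squash.comp hYF))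
  refine ⟨Z, fun ω => 2 * c ω, ?_, ?_, measurable_const.mul hcm,
    Filter.Eventually.of_forall fun ω => mul_pos two_pos (hc0 ω), ?_, fun i => ?_⟩
  · exact (hcm.mono hGF le_rfl).mul (hζ.mul
      ((measurable_const.add (measurable_norm.comp hYF)).inv.mul hYmF))
  · filter_upwards [hζ0] with ω a
    exact mul_pos (hc0 ω) (mul_pos a (mul_pos (by positivity) (marginal_pos _)))
  · filter_upwards [hζ0] with ω a
    have h1 : (1 + ‖Y ω‖)⁻¹ * marginal (h ω ⬝ᵥ squash (Y ω)) ≤ 1 * 2 :=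
      mul_le_mul (inv_le_one_of_one_le₀ (by linarith [norm_nonneg (Y ω)])) (marginal_le_two _)
        (marginal_pos _).le zero_le_one
    calc Z ω ≤ c ω * (ζ ω * (1 * 2)) := by
          have := (hc0 ω).le
          simp only [hZ]
          gcongr
      _ = 2 * c ω * ζ ω := by ring
  · refine ((hgen i).mul_left hm ?_ hcm.stronglyMeasurable
      (Filter.Eventually.of_forall fun ω => (hc0 ω).le)).congr ?_ ?_
    · exact (((measurable_pi_apply i).comp (measurable_squash.comp hY)).mul
        (hYmF.mono hF le_rfl)).aemeasurable
    · refine Filter.Eventually.of_forall fun ω => ?_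
      simp only [hZ, squash, Pi.smul_apply, smul_eq_mul, hYdef]
      ring
    · refine Filter.Eventually.of_forall fun ω => ?_
      have h1 := (marginal_pos (h ω ⬝ᵥ squash (-P₀ ω))).ne'
      have h2 : 1 + ‖-P₀ ω‖ ≠ 0 := by positivity
      simp only [hc]
      field_simp

end OneStepMarket

/-! ### Truncation with a correction of the mean -/

section Tilt

variable {n : ℕ}

/-- A smooth truncation factor: `trunc k a * a` is bounded, and `trunc k a → 1` as `k → ∞`. -/
noncomputable def trunc (k a : ℝ) : ℝ := max k 1 / (max k 1 + |a|)

lemma trunc_pos (k a : ℝ) : 0 < trunc k a := by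
  have : 0 < max k 1 := lt_max_of_lt_right one_pos
  unfold trunc; positivity

lemma trunc_le_one (k a : ℝ) : trunc k a ≤ 1 := by
  have : 0 < max k 1 := lt_max_of_lt_right one_pos
  exact (div_le_one (by positivity)).2 (by linarith [abs_nonneg a])

lemma inv_le_trunc (k a : ℝ) : (1 + |a|)⁻¹ ≤ trunc k a := by
  have h0 : 0 < max k 1 := lt_max_of_lt_right one_pos
  have h1 : 1 ≤ max k 1 := le_max_right _ _
  unfold trunc
  rw [inv_eq_one_div, div_le_div_iff₀ (by positivity) (by positivity)]
  nlinarith [abs_nonneg a]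

lemma trunc_mul_abs_le (k a : ℝ) : trunc k a * |a| ≤ max k 1 := by
  have h0 : 0 < max k 1 := lt_max_of_lt_right one_pos
  unfold trunc
  rw [div_mul_eq_mul_div, div_le_iff₀ (by positivity)]
  nlinarith [abs_nonneg a]

lemma continuous_trunc : Continuous fun p : ℝ × ℝ => trunc p.1 p.2 := by
  unfold trunc
  refine Continuous.div (by fun_prop) (by fun_prop) fun p => ?_
  have h0 : 0 < max p.1 1 := lt_max_of_lt_right one_pos
  positivity

lemma tendsto_trunc (a : ℝ) :
    Filter.Tendsto (fun k : ℕ => trunc k a) Filter.atTop (nhds 1) := by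
  have h : Filter.Tendsto (fun k : ℕ => 1 - |a| / ((k : ℝ) + |a|)) Filter.atTop (nhds (1 - 0)) :=
    (Filter.Tendsto.const_div_atTop
      (Filter.tendsto_atTop_add_const_right _ _ tendsto_natCast_atTop_atTop) _).const_sub 1
  rw [sub_zero] at h
  refine h.congr' ?_
  filter_upwards [Filter.eventually_ge_atTop 1] with k hk
  have hk1 : (1 : ℝ) ≤ k := by exact_mod_cast hk
  have h0 : (k : ℝ) + |a| ≠ 0 := by positivity
  unfold trunc
  rw [max_eq_left hk1]
  field_simp
  ring

/-- The bounded function used to correct the mean after truncation. -/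
noncomputable def corr (h : Fin n → ℝ) (x : (Fin n → ℝ) × ℝ) : ℝ :=
  h ⬝ᵥ x.1 / ((1 + |x.2|) * (1 + x.1 ⬝ᵥ x.1))

lemma dotProduct_self_nonneg' (q : Fin n → ℝ) : 0 ≤ q ⬝ᵥ q :=
  Finset.sum_nonneg fun i _ => mul_self_nonneg (q i)

lemma sq_le_dotProduct_self (q : Fin n → ℝ) (i : Fin n) : q i ^ 2 ≤ q ⬝ᵥ q := by
  rw [sq]
  exact Finset.single_le_sum (f := fun i => q i * q i) (fun j _ => mul_self_nonneg (q j))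
    (Finset.mem_univ i)

lemma abs_le_one_add_dotProduct_self (q : Fin n → ℝ) (i : Fin n) : |q i| ≤ 1 + q ⬝ᵥ q := by
  have := sq_le_dotProduct_self q i
  nlinarith [sq_abs (q i), sq_nonneg (|q i| - 1), abs_nonneg (q i)]

lemma corr_denom_pos (x : (Fin n → ℝ) × ℝ) : 0 < (1 + |x.2|) * (1 + x.1 ⬝ᵥ x.1) := by
  have := dotProduct_self_nonneg' x.1
  positivity

lemma abs_corr_le (h : Fin n → ℝ) (x : (Fin n → ℝ) × ℝ) :
    |corr h x| ≤ (∑ i, |h i|) * (1 + |x.2|)⁻¹ := by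
  have h0 := dotProduct_self_nonneg' x.1
  have h1 : |h ⬝ᵥ x.1| ≤ (∑ i, |h i|) * (1 + x.1 ⬝ᵥ x.1) := by
    refine (Finset.abs_sum_le_sum_abs _ _).trans ?_
    rw [Finset.sum_mul]
    refine Finset.sum_le_sum fun i _ => ?_
    rw [abs_mul]
    exact mul_le_mul_of_nonneg_left (abs_le_one_add_dotProduct_self _ i) (abs_nonneg _)
  unfold corr
  rw [abs_div, abs_of_pos (corr_denom_pos x), div_le_iff₀ (corr_denom_pos x)]
  refine h1.trans_eq ?_
  field_simp

lemma abs_corr_le' (h : Fin n → ℝ) (x : (Fin n → ℝ) × ℝ) : |corr h x| ≤ ∑ i, |h i| :=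
  (abs_corr_le h x).trans <| mul_le_of_le_one_right (Finset.sum_nonneg fun _ _ => abs_nonneg _)
    (inv_le_one_of_one_le₀ (by linarith [abs_nonneg x.2]))

/-- The numerator is quadratic in `x.1`, and so is the denominator; the bound needs no
integrability. -/
lemma abs_mul_corr_le (h : Fin n → ℝ) (x : (Fin n → ℝ) × ℝ) (i : Fin n) :
    |x.1 i * corr h x| ≤ ∑ j, |h j| := by
  have h0 := dotProduct_self_nonneg' x.1
  have h1 : |x.1 i| * |h ⬝ᵥ x.1| ≤ (∑ j, |h j|) * (1 + x.1 ⬝ᵥ x.1) := by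
    refine (mul_le_mul_of_nonneg_left (Finset.abs_sum_le_sum_abs _ _) (abs_nonneg _)).trans ?_
    rw [Finset.mul_sum, Finset.sum_mul]
    refine Finset.sum_le_sum fun j _ => ?_
    rw [abs_mul, mul_left_comm]
    refine mul_le_mul_of_nonneg_left ?_ (abs_nonneg _)
    nlinarith [sq_le_dotProduct_self x.1 i, sq_le_dotProduct_self x.1 j, sq_abs (x.1 i),
      sq_abs (x.1 j), sq_nonneg (|x.1 i| - |x.1 j|)]
  unfold corr
  rw [abs_mul, abs_div, abs_of_pos (corr_denom_pos x), ← mul_div_assoc,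
    div_le_iff₀ (corr_denom_pos x)]
  refine h1.trans ?_
  have hs : 0 ≤ ∑ j, |h j| := Finset.sum_nonneg fun _ _ => abs_nonneg _
  refine mul_le_mul_of_nonneg_left ?_ hs
  nlinarith [mul_nonneg (abs_nonneg x.2) (add_nonneg zero_le_one h0)]

lemma continuous_dotProduct' : Continuous fun p : (Fin n → ℝ) × (Fin n → ℝ) => p.1 ⬝ᵥ p.2 :=
  continuous_finsetSum _ fun i _ => by fun_prop

lemma continuous_corr : Continuous fun p : (Fin n → ℝ) × ((Fin n → ℝ) × ℝ) => corr p.1 p.2 := by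
  refine Continuous.div (continuous_dotProduct'.comp (by fun_prop : Continuous
    fun p : (Fin n → ℝ) × ((Fin n → ℝ) × ℝ) => (p.1, p.2.1))) ?_ fun p => (corr_denom_pos p.2).ne'
  have : Continuous fun p : (Fin n → ℝ) × ((Fin n → ℝ) × ℝ) => p.2.1 ⬝ᵥ p.2.1 :=
    continuous_dotProduct'.comp (by fun_prop : Continuous
      fun p : (Fin n → ℝ) × ((Fin n → ℝ) × ℝ) => (p.2.1, p.2.1))
  fun_prop

/-- Truncation followed by a correction of the mean. -/
noncomputable def tilt (p : ℝ × (Fin n → ℝ)) (x : (Fin n → ℝ) × ℝ) : ℝ :=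
  trunc p.1 x.2 + corr p.2 x

lemma continuous_tilt :
    Continuous fun z : (ℝ × (Fin n → ℝ)) × ((Fin n → ℝ) × ℝ) => tilt z.1 z.2 :=
  (continuous_trunc.comp (by fun_prop : Continuous
    fun z : (ℝ × (Fin n → ℝ)) × ((Fin n → ℝ) × ℝ) => (z.1.1, z.2.2))).add
  (continuous_corr.comp (by fun_prop : Continuous
    fun z : (ℝ × (Fin n → ℝ)) × ((Fin n → ℝ) × ℝ) => (z.1.2, z.2)))

/-- The factor 1 / (1 + |a|) in `corr` lies below every truncation factor. The correction is thus a
`δ`-fraction of the truncation, which keeps `tilt` positive for `δ < 1` and preserves the taming of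
`a`. -/
lemma abs_corr_le_mul_trunc {δ : ℝ} {p : ℝ × (Fin n → ℝ)} (hp : ∑ i, |p.2 i| ≤ δ)
    (x : (Fin n → ℝ) × ℝ) : |corr p.2 x| ≤ δ * trunc p.1 x.2 := by
  have h0 : 0 ≤ ∑ i, |p.2 i| := Finset.sum_nonneg fun _ _ => abs_nonneg _
  exact (abs_corr_le p.2 x).trans
    (mul_le_mul hp (inv_le_trunc _ _) (by positivity) (h0.trans hp))

lemma tilt_pos {δ : ℝ} (hδ : δ < 1) {p : ℝ × (Fin n → ℝ)} (hp : ∑ i, |p.2 i| ≤ δ)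
    (x : (Fin n → ℝ) × ℝ) : 0 < tilt p x := by
  have h1 := (abs_le.1 (abs_corr_le_mul_trunc hp x)).1
  have h2 := trunc_pos p.1 x.2
  unfold tilt
  nlinarith

lemma tilt_le {δ : ℝ} {p : ℝ × (Fin n → ℝ)} (hp : ∑ i, |p.2 i| ≤ δ)
    (x : (Fin n → ℝ) × ℝ) : tilt p x ≤ (1 + δ) * trunc p.1 x.2 := by
  have h1 := (abs_le.1 (abs_corr_le_mul_trunc hp x)).2
  unfold tilt
  linarith

lemma abs_tilt_sub_one_le (p : ℝ × (Fin n → ℝ)) (x : (Fin n → ℝ) × ℝ) :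
    |tilt p x - 1| ≤ (1 - trunc p.1 x.2) + ∑ i, |p.2 i| := by
  have h1 := abs_corr_le' p.2 x
  have h2 := trunc_le_one p.1 x.2
  have h3 : tilt p x - 1 = -(1 - trunc p.1 x.2) + corr p.2 x := by unfold tilt; ring
  rw [h3]
  refine (abs_add_le _ _).trans ?_
  rw [abs_neg, abs_of_nonneg (by linarith : 0 ≤ 1 - trunc p.1 x.2)]
  linarith

lemma abs_tilt_sub_one_le' (p : ℝ × (Fin n → ℝ)) (x : (Fin n → ℝ) × ℝ) :
    |tilt p x - 1| ≤ 1 + ∑ i, |p.2 i| :=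
  (abs_tilt_sub_one_le p x).trans (by linarith [trunc_pos p.1 x.2])

/-- For an integrable random vector, the truncation can be chosen mild, with a small correction
which restores the mean. -/
lemma exists_tilt {ν : Measure ((Fin n → ℝ) × ℝ)} [IsProbabilityMeasure ν]
    (hν : ∀ i, Integrable (fun x : (Fin n → ℝ) × ℝ => x.1 i) ν) {δ : ℝ} (hδ : 0 < δ) :
    ∃ p : ℝ × (Fin n → ℝ), ∑ i, |p.2 i| ≤ δ ∧ ∫ x, (1 - trunc p.1 x.2) ∂ν ≤ δ ∧
      ∀ i, ∫ x, x.1 i * (tilt p x - 1) ∂ν = 0 := by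
  have htm : ∀ k : ℝ, Measurable fun x : (Fin n → ℝ) × ℝ => 1 - trunc k x.2 := fun k =>
    (continuous_const.sub (continuous_trunc.comp (by fun_prop : Continuous
      fun x : (Fin n → ℝ) × ℝ => (k, x.2)))).measurable
  have hcm : ∀ h : Fin n → ℝ, Measurable fun x : (Fin n → ℝ) × ℝ => corr h x := fun h =>
    (continuous_corr.comp (by fun_prop : Continuous
      fun x : (Fin n → ℝ) × ℝ => (h, x))).measurable
  have hqm : ∀ i, Measurable fun x : (Fin n → ℝ) × ℝ => x.1 i := fun i => by fun_prop
  have ht1 : ∀ k a, |1 - trunc k a| ≤ 1 := fun k a => by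
    rw [abs_of_nonneg (by linarith [trunc_le_one k a])]
    linarith [trunc_pos k a]
  have hci : ∀ h i, Integrable (fun x : (Fin n → ℝ) × ℝ => x.1 i * corr h x) ν := fun h i =>
    integrable_of_abs_le ((hqm i).mul (hcm h)) fun x => abs_mul_corr_le h x i
  have hti : ∀ k i, Integrable (fun x : (Fin n → ℝ) × ℝ => x.1 i * (1 - trunc k x.2)) ν :=
    fun k i => (hν i).mul_bdd (c := 1) (htm k).aestronglyMeasurable
      (Filter.Eventually.of_forall fun x => ht1 k x.2)
  -- The change of mean caused by the correction is a Gram operator applied to `h`; `D k` below is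
  -- the mean lost by truncation at level `k`, so `L h = D k` is to be solved with small `h`.
  let L : (Fin n → ℝ) →ₗ[ℝ] (Fin n → ℝ) :=
    { toFun := fun h i => ∫ x, x.1 i * corr h x ∂ν
      map_add' := fun h h' => by
        ext i
        rw [Pi.add_apply, ← integral_add (hci h i) (hci h' i)]
        refine integral_congr_ae (Filter.Eventually.of_forall fun x => ?_)
        simp only [corr, add_dotProduct]
        ring
      map_smul' := fun c h => by
        ext i
        rw [Pi.smul_apply, smul_eq_mul, RingHom.id_apply, ← integral_const_mul]
        refine integral_congr_ae (Filter.Eventually.of_forall fun x => ?_)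
        simp only [corr, smul_dotProduct, smul_eq_mul]
        ring }
  set D : ℕ → Fin n → ℝ := fun k i => ∫ x, x.1 i * (1 - trunc k x.2) ∂ν with hD
  have hdot : ∀ (u : Fin n → ℝ) (f : (Fin n → ℝ) × ℝ → ℝ),
      (∀ i, Integrable (fun x : (Fin n → ℝ) × ℝ => x.1 i * f x) ν) →
      ∑ i, u i * ∫ x, x.1 i * f x ∂ν = ∫ x, u ⬝ᵥ x.1 * f x ∂ν := fun u f hf => by
    simp_rw [← integral_const_mul]
    rw [← integral_finsetSum _ fun i _ => (hf i).const_mul (u i)]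
    refine integral_congr_ae (Filter.Eventually.of_forall fun x => ?_)
    simp only [dotProduct, Finset.sum_mul, mul_assoc]
  -- A functional `u` that kills the range of `L` kills `L u`; pairing gives a weighted integral of
  -- (u · x)² equal to 0. Hence u · x = 0 almost everywhere, and `u` kills `D k` too. No
  -- non-degeneracy of the law is needed.
  have hrange : ∀ k, D k ∈ LinearMap.range L := fun k => by
    by_contra hk
    obtain ⟨f, hf, hLf⟩ := Submodule.exists_le_ker_of_notMem hk
    set u : Fin n → ℝ := fun i => f (fun j => if i = j then 1 else 0) with hu
    have hfu : ∀ x, f x = ∑ i, u i * x i := fun x => by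
      rw [LinearMap.pi_apply_eq_sum_univ f x]
      simp only [smul_eq_mul, hu]
      exact Finset.sum_congr rfl fun i _ => by
        rw [mul_comm]
    have h1 : f (L u) = 0 := hLf ⟨u, rfl⟩
    rw [hfu] at h1
    have h2 := (hdot u _ (hci u)).symm.trans h1
    have h3 : ∀ x : (Fin n → ℝ) × ℝ,
        u ⬝ᵥ x.1 * corr u x = (u ⬝ᵥ x.1) ^ 2 / ((1 + |x.2|) * (1 + x.1 ⬝ᵥ x.1)) := fun x => by
      unfold corr; ring
    have hint : Integrable (fun x : (Fin n → ℝ) × ℝ => u ⬝ᵥ x.1 * corr u x) ν := by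
      simp only [dotProduct, Finset.sum_mul, mul_assoc]
      exact integrable_finsetSum _ fun i _ => (hci u i).const_mul (u i)
    have h4 := (integral_eq_zero_iff_of_nonneg (fun x => by
      rw [h3]; exact div_nonneg (sq_nonneg _) (corr_denom_pos x).le) hint).1 h2
    refine hf ?_
    rw [hfu, hD, hdot u _ (hti k), integral_eq_zero_of_ae]
    filter_upwards [h4] with x hx
    rw [h3, Pi.zero_apply, div_eq_zero_iff, or_iff_left (corr_denom_pos x).ne',
      sq_eq_zero_iff] at hx
    rw [hx, zero_mul, Pi.zero_apply]
  have hD0 : Filter.Tendsto D Filter.atTop (nhds 0) := by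
    refine tendsto_pi_nhds.2 fun i => ?_
    have h1 := tendsto_integral_of_dominated_convergence (μ := ν)
      (F := fun (k : ℕ) (x : (Fin n → ℝ) × ℝ) => x.1 i * (1 - trunc k x.2)) (f := fun _ => 0)
      (fun x => |x.1 i|) (fun k => ((hqm i).mul (htm k)).aestronglyMeasurable) (hν i).abs
      (fun k => Filter.Eventually.of_forall fun x => by
        rw [Real.norm_eq_abs, abs_mul]
        exact mul_le_of_le_one_right (abs_nonneg _) (ht1 _ _))
      (Filter.Eventually.of_forall fun x => by
        simpa using ((tendsto_trunc x.2).const_sub 1).const_mul (x.1 i))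
    simpa using h1
  have hT0 : Filter.Tendsto (fun k : ℕ => ∫ x, (1 - trunc k x.2) ∂ν) Filter.atTop (nhds 0) := by
    have h1 := tendsto_integral_of_dominated_convergence (μ := ν)
      (F := fun (k : ℕ) (x : (Fin n → ℝ) × ℝ) => 1 - trunc k x.2) (f := fun _ => 0)
      (fun x => 1) (fun k => (htm k).aestronglyMeasurable) (integrable_const _)
      (fun k => Filter.Eventually.of_forall fun x => ht1 _ _)
      (Filter.Eventually.of_forall fun x => by
        simpa using (tendsto_trunc x.2).const_sub 1)
    simpa using h1
  -- A linear right inverse in finite dimension is continuous, so the corrections tend to 0 with `D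
  -- k`.
  obtain ⟨g, hg⟩ := L.rangeRestrict.exists_rightInverse_of_surjective L.range_rangeRestrict
  have hgc : Continuous g := g.continuous_of_finiteDimensional
  have hDr : Filter.Tendsto (fun k => (⟨D k, hrange k⟩ : LinearMap.range L)) Filter.atTop
      (nhds 0) := tendsto_subtype_rng.2 hD0
  have hh0 : Filter.Tendsto (fun k => ∑ i, |g ⟨D k, hrange k⟩ i|) Filter.atTop (nhds 0) := by
    have hc : Continuous fun z : LinearMap.range L => ∑ i, |g z i| := by fun_prop
    have h := (hc.tendsto 0).comp hDr
    simp only [map_zero, Pi.zero_apply, abs_zero, Finset.sum_const_zero] at h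
    exact h
  obtain ⟨k, hk1, hk2⟩ := ((hh0.eventually (ge_mem_nhds hδ)).and
    (hT0.eventually (ge_mem_nhds hδ))).exists
  refine ⟨(k, g ⟨D k, hrange k⟩), hk1, hk2, fun i => ?_⟩
  have h1 : L (g ⟨D k, hrange k⟩) i = D k i := by
    have := congrArg (fun z : LinearMap.range L => (z : Fin n → ℝ) i)
      (LinearMap.congr_fun hg ⟨D k, hrange k⟩)
    simpa using this
  have h2 : ∀ x : (Fin n → ℝ) × ℝ, x.1 i * (tilt ((k : ℝ), g ⟨D k, hrange k⟩) x - 1) =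
      x.1 i * corr (g ⟨D k, hrange k⟩) x - x.1 i * (1 - trunc k x.2) := fun x => by
    unfold tilt; ring
  simp_rw [h2]
  rw [integral_sub (hci _ i) (hti k i), sub_eq_zero]
  exact h1

end Tilt

/-! ### Conditional changes of density -/

section TiltSelection

variable {n : ℕ}

lemma exists_measurable_tilt {α : Type*} [MeasurableSpace α]
    (κ : Kernel α ((Fin n → ℝ) × ℝ)) [IsMarkovKernel κ] {δ : ℝ} (hδ : 0 < δ) :
    ∃ p : α → ℝ × (Fin n → ℝ), Measurable p ∧ (∀ a, ∑ i, |(p a).2 i| ≤ δ) ∧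
      ∀ a, (∀ i, Integrable (fun x : (Fin n → ℝ) × ℝ => x.1 i) (κ a)) →
        ∫ x, (1 - trunc (p a).1 x.2) ∂κ a ≤ δ ∧
        ∀ i, ∫ x, x.1 i * (tilt (p a) x - 1) ∂κ a = 0 := by
  classical
  have hqm : ∀ i, Measurable fun x : (Fin n → ℝ) × ℝ => x.1 i := fun i => by fun_prop
  have htiltm : Measurable fun z : (ℝ × (Fin n → ℝ)) × ((Fin n → ℝ) × ℝ) => tilt z.1 z.2 :=
    continuous_tilt.measurable
  have htrm : Measurable fun z : (ℝ × (Fin n → ℝ)) × ((Fin n → ℝ) × ℝ) =>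
      1 - trunc z.1.1 z.2.2 :=
    (continuous_const.sub (continuous_trunc.comp (by fun_prop : Continuous
      fun z : (ℝ × (Fin n → ℝ)) × ((Fin n → ℝ) × ℝ) => (z.1.1, z.2.2)))).measurable
  set good : Set α := {a | ∀ i, Integrable (fun x : (Fin n → ℝ) × ℝ => x.1 i) (κ a)} with hgood
  have hgm : MeasurableSet good := by
    have : good = ⋂ i, {a | Integrable (fun x : (Fin n → ℝ) × ℝ => x.1 i) (κ a)} := by
      ext a; simp [hgood]
    rw [this]
    exact MeasurableSet.iInter fun i => measurableSet_kernel_integrable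
      (f := fun _ (x : (Fin n → ℝ) × ℝ) => x.1 i) ((hqm i).comp measurable_snd).stronglyMeasurable
  set G : α → (ℝ × (Fin n → ℝ)) → ℝ := fun a p =>
    max (∑ i, |p.2 i| - δ) 0 + (max (∫ x, (1 - trunc p.1 x.2) ∂κ a - δ) 0 +
      ∑ i, |∫ x, x.1 i * (tilt p x - 1) ∂κ a|) with hG
  have hs0 : ∀ a (p : ℝ × (Fin n → ℝ)), 0 ≤ ∑ i, |∫ x, x.1 i * (tilt p x - 1) ∂κ a| :=
    fun a p => Finset.sum_nonneg fun _ _ => abs_nonneg _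
  have hG0 : ∀ a p, 0 ≤ G a p := fun a p => by
    have := hs0 a p
    positivity
  have hGzero : ∀ a p, G a p = 0 ↔ ∑ i, |p.2 i| ≤ δ ∧ ∫ x, (1 - trunc p.1 x.2) ∂κ a ≤ δ ∧
      ∀ i, ∫ x, x.1 i * (tilt p x - 1) ∂κ a = 0 := fun a p => by
    rw [hG, add_eq_zero_iff_of_nonneg (le_max_right _ _)
      (add_nonneg (le_max_right _ _) (hs0 a p)),
      add_eq_zero_iff_of_nonneg (le_max_right _ _) (hs0 a p),
      Finset.sum_eq_zero_iff_of_nonneg fun _ _ => abs_nonneg _]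
    simp
  have hGm : ∀ p : α → ℝ × (Fin n → ℝ), Measurable p → Measurable fun a => G a (p a) := by
    intro p hp
    have h1 : ∀ i, Measurable fun a => ∫ x, x.1 i * (tilt (p a) x - 1) ∂κ a := fun i =>
      (StronglyMeasurable.integral_kernel_prod_right' (κ := κ)
        (f := fun z => z.2.1 i * (tilt (p z.1) z.2 - 1))
        (((hqm i).comp measurable_snd).mul ((htiltm.comp ((hp.comp measurable_fst).prodMk
          measurable_snd)).sub measurable_const)).stronglyMeasurable).measurable
    have h2 : Measurable fun a => ∫ x, (1 - trunc (p a).1 x.2) ∂κ a :=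
      (StronglyMeasurable.integral_kernel_prod_right' (κ := κ)
        (f := fun z => 1 - trunc (p z.1).1 z.2.2)
        (htrm.comp ((hp.comp measurable_fst).prodMk measurable_snd)).stronglyMeasurable).measurable
    have h3 : Measurable fun a => ∑ i, |(p a).2 i| :=
      Finset.measurable_fun_sum _ fun i _ => measurable_norm.comp
        ((measurable_pi_apply i).comp (measurable_snd.comp hp))
    exact ((h3.sub measurable_const).max measurable_const).add
      (((h2.sub measurable_const).max measurable_const).add
        (Finset.measurable_fun_sum _ fun i _ => measurable_norm.comp (h1 i)))
  have hGc : ∀ a ∈ good, Continuous (G a) := by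
    intro a ha
    have hsum : Continuous fun p : ℝ × (Fin n → ℝ) => ∑ i, |p.2 i| := by fun_prop
    have h1 : ∀ i, Continuous fun p => ∫ x, x.1 i * (tilt p x - 1) ∂κ a := fun i =>
      continuous_integral_of_abs_le_mul (ha i) (B := fun p => 1 + ∑ i, |p.2 i|) (by fun_prop)
        (fun p => (hqm i).mul ((htiltm.comp measurable_prodMk_left).sub measurable_const))
        (fun p x => by
          rw [abs_mul, mul_comm]
          exact mul_le_mul_of_nonneg_right (abs_tilt_sub_one_le' p x) (abs_nonneg _))
        fun x => continuous_const.mul ((continuous_tilt.comp (by fun_prop : Continuous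
          fun p : ℝ × (Fin n → ℝ) => (p, x))).sub continuous_const)
    have h2 : Continuous fun p : ℝ × (Fin n → ℝ) => ∫ x, (1 - trunc p.1 x.2) ∂κ a :=
      continuous_integral_of_abs_le (B := fun _ => 1) continuous_const
        (fun p => htrm.comp measurable_prodMk_left)
        (fun p x => by
          rw [abs_of_nonneg (by linarith [trunc_le_one p.1 x.2])]
          linarith [trunc_pos p.1 x.2])
        fun x => continuous_const.sub (continuous_trunc.comp (by fun_prop : Continuous
          fun p : ℝ × (Fin n → ℝ) => (p.1, x.2)))
    exact ((hsum.sub continuous_const).max continuous_const).add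
      (((h2.sub continuous_const).max continuous_const).add
        (continuous_finsetSum _ fun i _ => (h1 i).abs))
  -- Continuity in `p` is only available where the law is integrable, so `G` is replaced by 0
  -- elsewhere.
  obtain ⟨y, hy, hy'⟩ := exists_measurable_zero
    (G := fun a p => if a ∈ good then G a p else 0)
    (fun p => Measurable.ite hgm (hGm _ measurable_const) measurable_const)
    (fun a => by
      by_cases ha : a ∈ good
      · simpa only [ha, if_true] using hGc a ha
      · simpa only [ha, if_false] using continuous_const)
    (fun a p => by split_ifs; exacts [hG0 a p, le_rfl])
  have hZm : MeasurableSet {a | G a (y a) = 0} := hGm _ hy (measurableSet_singleton 0)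
  -- The default parameter 0 keeps the correction bound valid for every `a`, so that `tilt` will be
  -- positive everywhere.
  refine ⟨{a | G a (y a) = 0}.indicator y, hy.indicator hZm, fun a => ?_, fun a ha => ?_⟩
  · by_cases h : G a (y a) = 0
    · rw [Set.indicator_of_mem (by exact h)]
      exact ((hGzero _ _).1 h).1
    · rw [Set.indicator_of_notMem (by exact h)]
      simpa using hδ.le
  · have h : G a (y a) = 0 := by
      have h1 := hy' a (by
        obtain ⟨p, hp⟩ := exists_tilt ha hδ
        exact ⟨p, by rw [if_pos (show a ∈ good from ha)]; exact (hGzero _ _).2 hp⟩)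
      rwa [if_pos (show a ∈ good from ha)] at h1
    rw [Set.indicator_of_mem (by exact h)]
    exact ((hGzero _ _).1 h).2

variable {Ω : Type*} {mG mF mΩ : MeasurableSpace Ω} {μ : Measure Ω}

/-- A conditional change of density which preserves the generalised conditional expectation of `X`,
is close to one, and tames a given random variable `a`. -/
lemma exists_density_of_hasGenCondExp [IsProbabilityMeasure μ] (hGF : mG ≤ mF) (hF : mF ≤ mΩ)
    {X W : Ω → Fin n → ℝ} {a : Ω → ℝ} (hX : Measurable[mF] X) (ha : Measurable[mF] a)
    (hXW : ∀ i, HasGenCondExp μ mG (fun ω => X ω i) (fun ω => W ω i))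
    {δ : ℝ} (hδ : 0 < δ) (hδ1 : δ ≤ 1) :
    ∃ d R : Ω → ℝ, Measurable[mF] d ∧ Measurable[mG] R ∧ (∀ ω, 0 < d ω) ∧ (∀ ω, d ω ≤ 1 + δ) ∧
      (∀ ω, d ω * |a ω| ≤ R ω) ∧ ∫⁻ ω, ENNReal.ofReal |d ω - 1| ∂μ ≤ ENNReal.ofReal δ ∧
      ∀ i, HasGenCondExp μ mG (fun ω => X ω i * d ω) (fun ω => W ω i) := by
  have hm : mG ≤ mΩ := hGF.trans hF
  have hYF : Measurable[mF] fun ω => (X ω, a ω) := hX.prodMk ha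
  set Y : Ω → (Fin n → ℝ) × ℝ := fun ω => (X ω, a ω) with hYdef
  have hY : Measurable[mΩ] Y := hYF.mono hF le_rfl
  obtain ⟨κ, hκM, hκ⟩ := exists_isCondKernel (μ := μ) hm hY
  -- Half of `δ` is spent on the truncation and half on the correction.
  have hδ2 : 0 < δ / 2 := by linarith
  obtain ⟨p, hpm, hp1, hp⟩ := @exists_measurable_tilt n Ω mG κ hκM (δ / 2) hδ2
  have hsndm : Measurable[mG.prod inferInstance] fun z : Ω × ((Fin n → ℝ) × ℝ) => z.2 :=
    @measurable_snd _ _ mG _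
  have hpsm : Measurable[mG.prod inferInstance] fun z : Ω × ((Fin n → ℝ) × ℝ) => (p z.1, z.2) :=
    (hpm.comp (@measurable_fst _ _ mG _)).prodMk hsndm
  have hqm : ∀ i, Measurable fun x : (Fin n → ℝ) × ℝ => x.1 i := fun i => by fun_prop
  have hXκ : ∀ i, _ := fun i => (hκ.hasGenCondExp_iff (φ := fun z => z.2.1 i)
    ((hqm i).comp hsndm)).1 (hXW i)
  have hgood : ∀ᵐ ω ∂μ, ∀ i, Integrable (fun x : (Fin n → ℝ) × ℝ => x.1 i) (κ ω) :=
    ae_all_iff.2 fun i => (hXκ i).1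
  refine ⟨fun ω => tilt (p ω) (Y ω), fun ω => (1 + δ / 2) * max (p ω).1 1, ?_, ?_,
    fun ω => tilt_pos (by linarith) (hp1 ω) _, fun ω => ?_, fun ω => ?_, ?_, fun i => ?_⟩
  · exact continuous_tilt.measurable.comp ((hpm.mono hGF le_rfl).prodMk hYF)
  · exact measurable_const.mul ((measurable_fst.comp hpm).max measurable_const)
  · have h1 := tilt_le (hp1 ω) (Y ω)
    nlinarith [trunc_le_one (p ω).1 (Y ω).2]
  · have h1 := tilt_le (hp1 ω) (Y ω)
    have h2 := trunc_mul_abs_le (p ω).1 (a ω)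
    calc tilt (p ω) (Y ω) * |a ω| ≤ (1 + δ / 2) * trunc (p ω).1 (a ω) * |a ω| :=
          mul_le_mul_of_nonneg_right h1 (abs_nonneg _)
      _ ≤ (1 + δ / 2) * max (p ω).1 1 := by
          rw [mul_assoc]
          exact mul_le_mul_of_nonneg_left h2 (by linarith)
  · have htm : Measurable[mG.prod inferInstance] fun z : Ω × ((Fin n → ℝ) × ℝ) =>
        ENNReal.ofReal ((1 - trunc (p z.1).1 z.2.2) + δ / 2) := by
      have : Measurable fun z : (ℝ × (Fin n → ℝ)) × ((Fin n → ℝ) × ℝ) =>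
          (1 - trunc z.1.1 z.2.2) + δ / 2 :=
        ((continuous_const.sub (continuous_trunc.comp (by fun_prop : Continuous
          fun z : (ℝ × (Fin n → ℝ)) × ((Fin n → ℝ) × ℝ) => (z.1.1, z.2.2)))).add
            continuous_const).measurable
      exact (this.comp hpsm).ennreal_ofReal
    calc ∫⁻ ω, ENNReal.ofReal |tilt (p ω) (Y ω) - 1| ∂μ
        ≤ ∫⁻ ω, ENNReal.ofReal ((1 - trunc (p ω).1 (Y ω).2) + δ / 2) ∂μ :=
          lintegral_mono fun ω => ENNReal.ofReal_le_ofReal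
            ((abs_tilt_sub_one_le _ _).trans (by linarith [hp1 ω]))
      _ = ∫⁻ ω, ∫⁻ x, ENNReal.ofReal ((1 - trunc (p ω).1 x.2) + δ / 2) ∂κ ω ∂μ :=
          hκ.lintegral_eq hm htm
      _ ≤ ∫⁻ _, ENNReal.ofReal δ ∂μ := by
          refine lintegral_mono_ae ?_
          filter_upwards [hgood] with ω hω
          have hcm : Measurable fun x : (Fin n → ℝ) × ℝ => 1 - trunc (p ω).1 x.2 :=
            (continuous_const.sub (continuous_trunc.comp (by fun_prop : Continuous
              fun x : (Fin n → ℝ) × ℝ => ((p ω).1, x.2)))).measurable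
          have hci : Integrable (fun x : (Fin n → ℝ) × ℝ => 1 - trunc (p ω).1 x.2) (κ ω) :=
            integrable_of_abs_le (c := 1) hcm fun x => by
              rw [abs_of_nonneg (by linarith [trunc_le_one (p ω).1 x.2])]
              linarith [trunc_pos (p ω).1 x.2]
          rw [← ofReal_integral_eq_lintegral_ofReal
            (f := fun x : (Fin n → ℝ) × ℝ => 1 - trunc (p ω).1 x.2 + δ / 2)
            (hci.add (integrable_const _))
            (Filter.Eventually.of_forall fun x => by
              have := trunc_le_one (p ω).1 x.2
              exact add_nonneg (by linarith) hδ2.le)]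
          refine ENNReal.ofReal_le_ofReal ?_
          rw [integral_add hci (integrable_const _), integral_const, probReal_univ, one_smul]
          linarith [(hp ω hω).1]
      _ = ENNReal.ofReal δ := by simp
  · refine (hκ.hasGenCondExp_iff (φ := fun z => z.2.1 i * tilt (p z.1) z.2)
      (((hqm i).comp hsndm).mul (continuous_tilt.measurable.comp hpsm))).2 ?_
    have htl : ∀ ω, (∀ i, Integrable (fun x : (Fin n → ℝ) × ℝ => x.1 i) (κ ω)) →
        Integrable (fun x : (Fin n → ℝ) × ℝ => x.1 i * (tilt (p ω) x - 1)) (κ ω) := fun ω hω => by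
      refine (hω i).mul_bdd (c := 1 + ∑ i, |(p ω).2 i|) ?_
        (Filter.Eventually.of_forall fun x => abs_tilt_sub_one_le' (p ω) x)
      exact ((continuous_tilt.measurable.comp measurable_prodMk_left).sub
        measurable_const).aestronglyMeasurable
    have hsplit : ∀ ω (x : (Fin n → ℝ) × ℝ),
        x.1 i * tilt (p ω) x = x.1 i + x.1 i * (tilt (p ω) x - 1) := fun ω x => by ring
    refine ⟨?_, ?_⟩
    · filter_upwards [hgood] with ω hω
      simp only [hsplit]
      exact (hω i).add (htl ω hω)
    · filter_upwards [hgood, (hXκ i).2] with ω hω hW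
      simp only [hsplit]
      rw [integral_add (hω i) (htl ω hω), (hp ω hω).2 i, add_zero]
      exact hW

end TiltSelection

/-! ### From generalised martingales to martingales -/

section GenMartingale

variable {n : ℕ} {Ω : Type*} {mΩ : MeasurableSpace Ω} {μ : Measure Ω} {𝓕 : Filtration ℕ mΩ}

/-- A martingale in the sense of generalised conditional expectations. -/
structure IsGenMartingale (M : ℕ → Ω → Fin n → ℝ) (𝓕 : Filtration ℕ mΩ) (μ : Measure Ω) :
    Prop where
  measurable : ∀ t, Measurable[𝓕 t] (M t)
  hasGenCondExp : ∀ t i, HasGenCondExp μ (𝓕 t) (fun ω => M (t + 1) ω i) (fun ω => M t ω i)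

lemma IsGenMartingale.measurable_eval {M : ℕ → Ω → Fin n → ℝ} (hM : IsGenMartingale M 𝓕 μ)
    (t : ℕ) (i : Fin n) : Measurable[𝓕 t] fun ω => M t ω i :=
  (measurable_pi_apply i).comp (hM.measurable t)

lemma exists_lintegral_abs_trunc_sub_one_le [IsFiniteMeasure μ] {a : Ω → ℝ} (ha : Measurable a)
    {δ : ℝ} (hδ : 0 < δ) :
    ∃ k : ℝ, ∫⁻ ω, ENNReal.ofReal |trunc k (a ω) - 1| ∂μ ≤ ENNReal.ofReal δ := by
  have h := tendsto_lintegral_of_dominated_convergence (μ := μ)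
    (F := fun (k : ℕ) ω => ENNReal.ofReal |trunc k (a ω) - 1|) (f := fun _ => 0) (fun _ => 1)
    (fun k => by
      have : Measurable fun x : ℝ => |trunc k x - 1| :=
        ((continuous_trunc.comp (by fun_prop : Continuous fun x : ℝ => ((k : ℝ), x))).sub
          continuous_const).abs.measurable
      exact (this.comp ha).ennreal_ofReal)
    (fun k => Filter.Eventually.of_forall fun ω => by
      rw [← ENNReal.ofReal_one]
      refine ENNReal.ofReal_le_ofReal ?_
      rw [abs_sub_comm, abs_of_nonneg (by linarith [trunc_le_one k (a ω)])]
      linarith [trunc_pos k (a ω)])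
    (by simp)
    (Filter.Eventually.of_forall fun ω => by
      have h1 := ((tendsto_trunc (a ω)).sub_const 1).abs
      rw [sub_self, abs_zero] at h1
      simpa using ENNReal.tendsto_ofReal h1)
  rw [lintegral_zero] at h
  obtain ⟨k, hk⟩ := (h.eventually (ge_mem_nhds (ENNReal.ofReal_pos.2 hδ))).exists
  exact ⟨k, hk⟩

/-- A finite-horizon change of density which tames a given random variable. -/
lemma IsGenMartingale.exists_density [IsProbabilityMeasure μ] {M : ℕ → Ω → Fin n → ℝ}
    (hM : IsGenMartingale M 𝓕 μ) (T : ℕ) :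
    ∀ (a : Ω → ℝ), Measurable[𝓕 T] a → ∀ δ : ℝ, 0 < δ → δ ≤ 1 →
    ∃ D : ℕ → Ω → ℝ, (∀ t, Measurable[𝓕 t] (D t)) ∧ (∀ t ω, 0 < D t ω) ∧
      (∀ t ω, D t ω ≤ 1 + δ) ∧
      (∀ t, ∫⁻ ω, ENNReal.ofReal |D t ω - 1| ∂μ ≤ ENNReal.ofReal δ) ∧
      (∀ t, T ≤ t → D t = D T) ∧
      (∀ t i, HasGenCondExp μ (𝓕 t) (fun ω => D (t + 1) ω * M (t + 1) ω i)
        (fun ω => D t ω * M t ω i)) ∧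
      Integrable (fun ω => D T ω * a ω) μ := by
  have hMm : ∀ t i, AEMeasurable (fun ω => M t ω i) μ := fun t i =>
    ((hM.measurable_eval t i).mono (𝓕.le t) le_rfl).aemeasurable
  -- Taming goes backwards in time: a density `d` at time `T + 1` bounds `|a|` by some `R` known at
  -- time `T`, and the induction hypothesis is applied to `R`. At time 0 a plain truncation
  -- suffices, being known from the start.
  induction T with
  | zero =>
    intro a ha δ hδ _
    obtain ⟨k, hk⟩ := exists_lintegral_abs_trunc_sub_one_le (μ := μ) (ha.mono (𝓕.le 0) le_rfl) hδ
    have htm : Measurable fun x : ℝ => trunc k x :=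
      (continuous_trunc.comp (by fun_prop : Continuous fun x : ℝ => (k, x))).measurable
    have hm : Measurable[𝓕 0] fun ω => trunc k (a ω) := htm.comp ha
    refine ⟨fun _ ω => trunc k (a ω), fun t => hm.mono (𝓕.mono (Nat.zero_le t)) le_rfl,
      fun _ ω => trunc_pos _ _, fun _ ω => (trunc_le_one _ _).trans (by linarith), fun _ => hk,
      fun _ _ => rfl, fun t i => ?_, ?_⟩
    · exact (hM.hasGenCondExp t i).mul_left (𝓕.le t) (hMm _ _)
        (hm.mono (𝓕.mono (Nat.zero_le t)) le_rfl).stronglyMeasurable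
        (Filter.Eventually.of_forall fun ω => (trunc_pos _ _).le)
    · refine integrable_of_abs_le ((hm.mul ha).mono (𝓕.le 0) le_rfl) (c := max k 1) fun ω => ?_
      rw [abs_mul, abs_of_pos (trunc_pos _ _)]
      exact trunc_mul_abs_le _ _
  | succ T ih =>
    intro a ha δ hδ hδ1
    -- Two errors of size `δ / 3` and their product `δ² / 9` fit into `δ`, as `δ ≤ 1`.
    have hδ3 : 0 < δ / 3 := by linarith
    obtain ⟨d, R, hdm, hRm, hd0, hd1, hdR, hdI, hdG⟩ :=
      exists_density_of_hasGenCondExp (𝓕.mono T.le_succ) (𝓕.le _) (hM.measurable (T + 1)) ha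
        (hM.hasGenCondExp T) hδ3 (by linarith)
    obtain ⟨D, hDm, hD0, hD1, hDI, hDT, hDG, hDR⟩ := ih R hRm (δ / 3) hδ3 (by linarith)
    have hDdm : Measurable[𝓕 (T + 1)] fun ω => D T ω * d ω :=
      ((hDm T).mono (𝓕.mono T.le_succ) le_rfl).mul hdm
    refine ⟨fun t => if t ≤ T then D t else fun ω => D T ω * d ω, fun t => ?_, fun t ω => ?_,
      fun t ω => ?_, fun t => ?_, fun t ht => ?_, fun t i => ?_, ?_⟩
    · by_cases h : t ≤ T
      · simpa only [h, if_true] using hDm t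
      · simpa only [h, if_false] using hDdm.mono (𝓕.mono (by omega)) le_rfl
    · by_cases h : t ≤ T
      · simpa only [h, if_true] using hD0 t ω
      · simpa only [h, if_false] using mul_pos (hD0 T ω) (hd0 ω)
    · by_cases h : t ≤ T
      · simp only [h, if_true]
        linarith [hD1 t ω]
      · simp only [h, if_false]
        nlinarith [hD1 T ω, hd1 ω, hD0 T ω, hd0 ω]
    · by_cases h : t ≤ T
      · simp only [h, if_true]
        exact (hDI t).trans (ENNReal.ofReal_le_ofReal (by linarith))
      · simp only [h, if_false]
        calc ∫⁻ ω, ENNReal.ofReal |D T ω * d ω - 1| ∂μ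
            ≤ ∫⁻ ω, (ENNReal.ofReal (1 + δ / 3) * ENNReal.ofReal |d ω - 1| +
                ENNReal.ofReal |D T ω - 1|) ∂μ := by
              refine lintegral_mono fun ω => ?_
              rw [← ENNReal.ofReal_mul (by linarith), ← ENNReal.ofReal_add
                (mul_nonneg (by linarith) (abs_nonneg _)) (abs_nonneg _)]
              refine ENNReal.ofReal_le_ofReal ?_
              have : D T ω * d ω - 1 = D T ω * (d ω - 1) + (D T ω - 1) := by ring
              rw [this]
              refine (abs_add_le _ _).trans (add_le_add_left ?_ _)
              rw [abs_mul, abs_of_pos (hD0 T ω)]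
              exact mul_le_mul_of_nonneg_right (hD1 T ω) (abs_nonneg _)
          _ = ENNReal.ofReal (1 + δ / 3) * ∫⁻ ω, ENNReal.ofReal |d ω - 1| ∂μ +
                ∫⁻ ω, ENNReal.ofReal |D T ω - 1| ∂μ := by
              have h1 : Measurable fun ω => ENNReal.ofReal |D T ω - 1| := (measurable_norm.comp
                (((hDm T).mono (𝓕.le T) le_rfl).sub measurable_const)).ennreal_ofReal
              have h2 : Measurable fun ω => ENNReal.ofReal |d ω - 1| := (measurable_norm.comp
                ((hdm.mono (𝓕.le _) le_rfl).sub measurable_const)).ennreal_ofReal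
              rw [lintegral_add_right _ h1, lintegral_const_mul _ h2]
          _ ≤ ENNReal.ofReal (1 + δ / 3) * ENNReal.ofReal (δ / 3) + ENNReal.ofReal (δ / 3) := by
              gcongr
              exact hDI T
          _ ≤ ENNReal.ofReal δ := by
              rw [← ENNReal.ofReal_mul (by linarith), ← ENNReal.ofReal_add (by positivity) hδ3.le]
              exact ENNReal.ofReal_le_ofReal (by nlinarith)
    · have h1 : ¬ t ≤ T := by omega
      have h2 : ¬ T + 1 ≤ T := by omega
      simp only [h1, h2, if_false]
    · rcases lt_trichotomy t T with h | h | h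
      · have h1 : t ≤ T := h.le
        have h2 : t + 1 ≤ T := h
        simp only [h1, h2, if_true]
        exact hDG t i
      · subst h
        have h2 : ¬ t + 1 ≤ t := by omega
        simp only [le_refl, h2, if_true, if_false]
        refine ((hdG i).mul_left (𝓕.le t) (((hM.measurable_eval _ i).mul hdm).mono
          (𝓕.le _) le_rfl).aemeasurable (hDm t).stronglyMeasurable
          (Filter.Eventually.of_forall fun ω => (hD0 t ω).le)).congr
          (Filter.Eventually.of_forall fun ω => ?_) (Filter.EventuallyEq.refl _ _)
        ring
      · have h1 : ¬ t ≤ T := by omega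
        have h2 : ¬ t + 1 ≤ T := by omega
        simp only [h1, h2, if_false]
        exact (hM.hasGenCondExp t i).mul_left (𝓕.le t) (hMm _ _)
          (hDdm.mono (𝓕.mono (by omega)) le_rfl).stronglyMeasurable
          (Filter.Eventually.of_forall fun ω => (mul_pos (hD0 T ω) (hd0 ω)).le)
    · have h2 : ¬ T + 1 ≤ T := by omega
      simp only [h2, if_false]
      refine hDR.mono ((hDdm.mul ha).mono (𝓕.le _) le_rfl).aestronglyMeasurable
        (Filter.Eventually.of_forall fun ω => ?_)
      rw [norm_mul, norm_mul, norm_mul, mul_assoc]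
      refine mul_le_mul_of_nonneg_left ?_ (norm_nonneg _)
      rw [Real.norm_of_nonneg (hd0 ω).le]
      exact (hdR ω).trans (le_abs_self _)

/-- The generalised martingale property is preserved when the density is put into the process. -/
lemma IsGenMartingale.smul_of_hasGenCondExp {M : ℕ → Ω → Fin n → ℝ} {D : ℕ → Ω → ℝ}
    (hM : IsGenMartingale M 𝓕 μ) (hD : ∀ t, Measurable[𝓕 t] (D t))
    (h : ∀ t i, HasGenCondExp μ (𝓕 t) (fun ω => D (t + 1) ω * M (t + 1) ω i)
        (fun ω => D t ω * M t ω i)) :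
    IsGenMartingale (fun t ω => D t ω • M t ω) 𝓕 μ :=
  ⟨fun t => (hD t).smul (hM.measurable t), h⟩

/-- A sequence of density processes `E k`, each obtained from the previous one by a small change,
for which more and more of the variables `E k t • M t` are integrable. -/
lemma IsGenMartingale.exists_seq_density [IsProbabilityMeasure μ] {M : ℕ → Ω → Fin n → ℝ}
    (hM : IsGenMartingale M 𝓕 μ) :
    ∃ E D : ℕ → ℕ → Ω → ℝ, (∀ k t, Measurable[𝓕 t] (E k t)) ∧
      (∀ k, IsGenMartingale (fun t ω => E k t ω • M t ω) 𝓕 μ) ∧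
      (∀ t ω, E 0 t ω = 1) ∧ (∀ k t ω, E (k + 1) t ω = D k t ω * E k t ω) ∧
      (∀ k t, Measurable (D k t)) ∧ (∀ k t ω, 0 < D k t ω) ∧
      (∀ k t ω, D k t ω ≤ 1 + (1 / 2) ^ k) ∧
      (∀ k t, ∫⁻ ω, ENNReal.ofReal |D k t ω - 1| ∂μ ≤ ENNReal.ofReal ((1 / 2) ^ k)) ∧
      ∀ k, Integrable (fun ω => E (k + 1) k ω * ‖M k ω‖) μ := by
  let St := {E : ℕ → Ω → ℝ // (∀ t, Measurable[𝓕 t] (E t)) ∧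
    IsGenMartingale (fun t ω => E t ω • M t ω) 𝓕 μ}
  have step : ∀ (k : ℕ) (E : St), ∃ D : ℕ → Ω → ℝ, (∀ t, Measurable[𝓕 t] (D t)) ∧
      (∀ t ω, 0 < D t ω) ∧ (∀ t ω, D t ω ≤ 1 + (1 / 2) ^ k) ∧
      (∀ t, ∫⁻ ω, ENNReal.ofReal |D t ω - 1| ∂μ ≤ ENNReal.ofReal ((1 / 2) ^ k)) ∧
      IsGenMartingale (fun t ω => (D t ω * E.1 t ω) • M t ω) 𝓕 μ ∧
      Integrable (fun ω => (D k ω * E.1 k ω) * ‖M k ω‖) μ := fun k E => by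
    obtain ⟨D, h1, h2, h3, h4, -, h6, h7⟩ := E.2.2.exists_density k
      (fun ω => E.1 k ω * ‖M k ω‖) ((E.2.1 k).mul (measurable_norm.comp (hM.measurable k)))
      ((1 / 2) ^ k) (by positivity) (pow_le_one₀ (by norm_num) (by norm_num))
    refine ⟨D, h1, h2, h3, h4, ?_, ?_⟩
    · simpa only [smul_smul] using E.2.2.smul_of_hasGenCondExp h1 h6
    · simpa only [mul_assoc] using h7
  choose D h1 h2 h3 h4 h5 h6 using step
  let E : ℕ → St := fun k => Nat.rec
    ⟨fun _ _ => 1, fun _ => measurable_const, by simpa only [one_smul] using hM⟩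
    (fun k E => ⟨fun t ω => D k E t ω * E.1 t ω, fun t => (h1 k E t).mul (E.2.1 t), h5 k E⟩) k
  exact ⟨fun k => (E k).1, fun k => D k (E k), fun k => (E k).2.1, fun k => (E k).2.2,
    fun _ _ => rfl, fun _ _ _ => rfl, fun k t => (h1 k _ t).mono (𝓕.le t) le_rfl,
    fun k => h2 k _, fun k => h3 k _, fun k => h4 k _, fun k => h6 k (E k)⟩

lemma condExp_apply_ae_eq {m : MeasurableSpace Ω} {f : Ω → Fin n → ℝ} (hf : Integrable f μ)
    (i : Fin n) : (fun ω => μ[f | m] ω i) =ᵐ[μ] μ[fun ω => f ω i | m] :=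
  (ContinuousLinearMap.proj (R := ℝ) (φ := fun _ : Fin n => ℝ) i).comp_condExp_comm hf

/-- Every generalised martingale becomes a true martingale after a change of density. -/
theorem IsGenMartingale.exists_martingale [IsProbabilityMeasure μ] {M : ℕ → Ω → Fin n → ℝ}
    (hM : IsGenMartingale M 𝓕 μ) :
    ∃ L : ℕ → Ω → ℝ, (∀ t, Measurable[𝓕 t] (L t)) ∧ (∀ t, ∀ᵐ ω ∂μ, 0 < L t ω) ∧
      Martingale (fun t ω => L t ω • M t ω) 𝓕 μ := by
  obtain ⟨E, D, hEm, hEM, hE0, hED, hDm, hD0, hD1, hDI, hint⟩ := hM.exists_seq_density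
  have hEpos : ∀ k t ω, 0 < E k t ω := fun k t ω => by
    induction k with
    | zero => rw [hE0]; exact one_pos
    | succ k ih => rw [hED]; exact mul_pos (hD0 k t ω) ih
  have hEexp : ∀ k t ω, E k t ω = Real.exp (∑ j ∈ Finset.range k, Real.log (D j t ω)) :=
    fun k t ω => by
    induction k with
    | zero => simp [hE0]
    | succ k ih =>
      rw [hED, ih, Finset.sum_range_succ, Real.exp_add, Real.exp_log (hD0 k t ω), mul_comm]
  -- The later factors multiply to at most the exponential of the sum of (1/2)ˡ over all l, which is
  -- e². Integrability gained at one stage thus persists with a common dominating function.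
  have hEle : ∀ k j t ω, E (k + j) t ω ≤ Real.exp 2 * E k t ω := fun k j t ω => by
    have h1 : E (k + j) t ω ≤
        Real.exp (∑ l ∈ Finset.range j, (1 / 2 : ℝ) ^ l) * E k t ω := by
      induction j with
      | zero => simp
      | succ j ih =>
        rw [← add_assoc, hED, Finset.sum_range_succ, Real.exp_add]
        have h2 : D (k + j) t ω ≤ Real.exp ((1 / 2 : ℝ) ^ j) := by
          refine (hD1 (k + j) t ω).trans ?_
          have h3 : (1 / 2 : ℝ) ^ (k + j) ≤ (1 / 2) ^ j :=
            pow_le_pow_of_le_one (by norm_num) (by norm_num) (by omega)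
          linarith [Real.add_one_le_exp ((1 / 2 : ℝ) ^ j)]
        calc D (k + j) t ω * E (k + j) t ω ≤ Real.exp ((1 / 2 : ℝ) ^ j) *
              (Real.exp (∑ l ∈ Finset.range j, (1 / 2 : ℝ) ^ l) * E k t ω) :=
              mul_le_mul h2 ih (hEpos _ _ _).le (Real.exp_pos _).le
          _ = _ := by ring
    refine h1.trans (mul_le_mul_of_nonneg_right (Real.exp_le_exp.2 ?_) (hEpos _ _ _).le)
    exact (summable_geometric_two.sum_le_tsum _ fun _ _ => by positivity).trans_eq
      tsum_geometric_two
  -- The deviations |D - 1| have summable means, hence are almost surely summable, and the infinite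
  -- product has a positive limit.
  have hconv : ∀ t, ∀ᵐ ω ∂μ, ∃ l : ℝ, 0 < l ∧
      Filter.Tendsto (fun k => E k t ω) Filter.atTop (nhds l) := fun t => by
    have hDa : ∀ k, Measurable fun ω => ENNReal.ofReal |D k t ω - 1| := fun k =>
      (measurable_norm.comp ((hDm k t).sub measurable_const)).ennreal_ofReal
    have hfin : ∫⁻ ω, ∑' k, ENNReal.ofReal |D k t ω - 1| ∂μ ≠ ∞ := by
      rw [lintegral_tsum fun k => (hDa k).aemeasurable]
      refine ne_top_of_le_ne_top ?_ (ENNReal.tsum_le_tsum fun k => hDI k t)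
      rw [← ENNReal.ofReal_tsum_of_nonneg (fun k => by positivity) summable_geometric_two]
      exact ENNReal.ofReal_ne_top
    filter_upwards [ae_lt_top (Measurable.tsum hDa) hfin] with ω hω
    have hs : Summable fun k => D k t ω - 1 := by
      have := ENNReal.summable_toReal hω.ne
      simp only [ENNReal.toReal_ofReal (abs_nonneg _)] at this
      exact this.of_abs
    have hlog : Summable fun k => Real.log (D k t ω) := by
      simpa using Real.summable_log_one_add_of_summable hs
    refine ⟨_, Real.exp_pos (∑' k, Real.log (D k t ω)), ?_⟩
    simp only [hEexp]
    exact (Real.continuous_exp.tendsto _).comp hlog.hasSum.tendsto_sum_nat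
  -- A limsup is `𝓕 t`-measurable everywhere, with no completeness assumption on the filtration.
  set L : ℕ → Ω → ℝ := fun t ω => Filter.limsup (fun k => E k t ω) Filter.atTop with hL
  have hLt : ∀ t, ∀ᵐ ω ∂μ, 0 < L t ω ∧
      Filter.Tendsto (fun k => E k t ω) Filter.atTop (nhds (L t ω)) := fun t => by
    filter_upwards [hconv t] with ω ⟨l, hl0, hl⟩
    rw [hL]
    simp only [hl.limsup_eq]
    exact ⟨hl0, hl⟩
  have hLm : ∀ t, Measurable[𝓕 t] (L t) := fun t => Measurable.limsup fun k => hEm k t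
  have hbound : ∀ t k ω i, ‖E (t + 1 + k) t ω * M t ω i‖ ≤
      Real.exp 2 * (E (t + 1) t ω * ‖M t ω‖) := fun t k ω i => by
    rw [norm_mul, Real.norm_of_nonneg (hEpos _ _ _).le, ← mul_assoc]
    exact mul_le_mul (hEle _ _ _ _) (norm_le_pi_norm _ i) (norm_nonneg _)
      (mul_nonneg (Real.exp_pos _).le (hEpos _ _ _).le)
  have hdom : ∀ t, Integrable (fun ω => Real.exp 2 * (E (t + 1) t ω * ‖M t ω‖)) μ := fun t =>
    (hint t).const_mul _
  have hMi : ∀ t i, Measurable[𝓕 t] fun ω => M t ω i := fun t i => hM.measurable_eval t i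
  have hEi : ∀ t k i, Integrable (fun ω => E (t + 1 + k) t ω * M t ω i) μ := fun t k i =>
    (hdom t).mono' (((hEm _ t).mul (hMi t i)).mono (𝓕.le t) le_rfl).aestronglyMeasurable
      (Filter.Eventually.of_forall fun ω => hbound t k ω i)
  have htend : ∀ t i, ∀ᵐ ω ∂μ, Filter.Tendsto (fun k => E (t + 1 + k) t ω * M t ω i)
      Filter.atTop (nhds (L t ω * M t ω i)) := fun t i => by
    filter_upwards [hLt t] with ω hω
    refine Filter.Tendsto.mul_const _ (hω.2.comp ?_)
    exact Filter.tendsto_atTop_mono (fun k => Nat.le_add_left k (t + 1)) Filter.tendsto_id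
  have hLi : ∀ t i, Integrable (fun ω => L t ω * M t ω i) μ := fun t i => by
    refine (hdom t).mono' (((hLm t).mul (hMi t i)).mono (𝓕.le t) le_rfl).aestronglyMeasurable ?_
    filter_upwards [htend t i] with ω hω
    exact le_of_tendsto hω.norm (Filter.Eventually.of_forall fun k => hbound t k ω i)
  have hLI : ∀ t, Integrable (fun ω => L t ω • M t ω) μ := fun t => Integrable.of_eval (hLi t)
  refine ⟨L, hLm, fun t => (hLt t).mono fun ω h => h.1, martingale_nat
    (fun t => ((hLm t).smul (hM.measurable t)).stronglyMeasurable) hLI fun t => ?_⟩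
  have hcomp : ∀ i, μ[fun ω => L (t + 1) ω * M (t + 1) ω i | 𝓕 t] =ᵐ[μ]
      fun ω => L t ω * M t ω i := fun i => by
    -- Domination starts at stage `t + 2` for time `t + 1` and at stage `t + 1` for time `t`; the
    -- index `1 + k` on the right puts both sides at the same stage.
    have h1 := tendsto_condExp_unique (m := 𝓕 t) (μ := μ)
      (fun k ω => E (t + 1 + 1 + k) (t + 1) ω * M (t + 1) ω i)
      (fun k ω => E (t + 1 + (1 + k)) t ω * M t ω i) _ _
      (fun k => hEi (t + 1) k i) (fun k => hEi t (1 + k) i) (htend (t + 1) i)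
      ((htend t i).mono fun ω hω => hω.comp
        (Filter.tendsto_atTop_mono (fun k => Nat.le_add_left k 1) Filter.tendsto_id))
      _ (hdom (t + 1)) _ (hdom t)
      (fun k => Filter.Eventually.of_forall fun ω => hbound (t + 1) k ω i)
      (fun k => Filter.Eventually.of_forall fun ω => hbound t (1 + k) ω i)
      (fun k => by
        have h2 : μ[fun ω => E (t + 1 + (1 + k)) t ω * M t ω i | 𝓕 t] = _ :=
          condExp_of_stronglyMeasurable (𝓕.le t) ((hEm _ t).mul (hMi t i)).stronglyMeasurable
            (hEi t (1 + k) i)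
        rw [h2, ← add_assoc]
        exact ((hEM (t + 1 + 1 + k)).hasGenCondExp t i).condExp_ae_eq (hEi (t + 1) k i))
    have h2 : μ[fun ω => L t ω * M t ω i | 𝓕 t] = _ :=
      condExp_of_stronglyMeasurable (𝓕.le t) ((hLm t).mul (hMi t i)).stronglyMeasurable (hLi t i)
    rwa [h2] at h1
  have hall : ∀ᵐ ω ∂μ, ∀ i, μ[fun ω => L (t + 1) ω • M (t + 1) ω | 𝓕 t] ω i =
      L t ω * M t ω i := ae_all_iff.2 fun i => by
    filter_upwards [condExp_apply_ae_eq (m := 𝓕 t) (hLI (t + 1)) i, hcomp i] with ω a b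
    rw [a]
    exact b
  filter_upwards [hall] with ω hω
  ext i
  exact (hω i).symm

end GenMartingale

/-! ### One-period and multi-period arbitrage -/

section NoArbitrage

variable {n : ℕ} {Ω : Type*} {mG mΩ : MeasurableSpace Ω} {μ : Measure Ω}

/-- Held only on the event where its cost is negative, `h` would be an arbitrage. -/
lemma OneStepNA.nonneg {P₀ P₁ : Ω → Fin n → ℝ} (hP₀ : Measurable[mG] P₀)
    (hNA : OneStepNA μ mG P₀ P₁) {h : Ω → Fin n → ℝ} (hh : Measurable[mG] h)
    (h1 : ∀ᵐ ω ∂μ, 0 ≤ h ω ⬝ᵥ P₁ ω) : ∀ᵐ ω ∂μ, 0 ≤ h ω ⬝ᵥ P₀ ω := by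
  have hB : MeasurableSet[mG] {ω | h ω ⬝ᵥ P₀ ω < 0} :=
    measurable_dotProduct hh hP₀ measurableSet_Iio
  have h2 := (hNA ({ω | h ω ⬝ᵥ P₀ ω < 0}.indicator h) (hh.indicator hB)
    (Filter.Eventually.of_forall fun ω => by
      by_cases hω : h ω ⬝ᵥ P₀ ω < 0
      · rw [Set.indicator_of_mem (by exact hω)]; exact hω.le
      · rw [Set.indicator_of_notMem (by exact hω), zero_dotProduct])
    (by
      filter_upwards [h1] with ω a
      by_cases hω : h ω ⬝ᵥ P₀ ω < 0
      · rw [Set.indicator_of_mem (by exact hω)]; exact a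
      · rw [Set.indicator_of_notMem (by exact hω), zero_dotProduct])).1
  filter_upwards [h2] with ω a
  by_contra hω
  rw [not_le] at hω
  rw [Set.indicator_of_mem (by exact hω)] at a
  exact hω.ne a

/-- A one-period martingale admits no arbitrage. -/
lemma oneStepNA_of_condExp [IsFiniteMeasure μ] (hm : mG ≤ mΩ) {X₀ X₁ : Ω → Fin n → ℝ}
    (hX₀ : Integrable X₀ μ) (hX₁ : Integrable X₁ μ) (hX : μ[X₁ | mG] =ᵐ[μ] X₀) :
    OneStepNA μ mG X₀ X₁ := by
  intro h hh h0 h1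
  have hs : Measurable[mG] fun ω => ∑ i, |h ω i| :=
    Finset.measurable_fun_sum _ fun i _ => measurable_norm.comp ((measurable_pi_apply i).comp hh)
  -- On the event that `h` is bounded by `k`, which is known at the first date, the products with
  -- the prices are integrable and `h` can be pulled out of the conditional expectation.
  have key : ∀ k : ℕ, ∀ᵐ ω ∂μ, ∑ i, |h ω i| ≤ k → h ω ⬝ᵥ X₀ ω = 0 ∧ h ω ⬝ᵥ X₁ ω = 0 := by
    intro k
    set A : Set Ω := {ω | ∑ i, |h ω i| ≤ k} with hA
    have hAm : MeasurableSet[mG] A := hs measurableSet_Iic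
    set g : Ω → Fin n → ℝ := A.indicator h with hg
    have hgm : Measurable[mG] g := hh.indicator hAm
    have hgi : ∀ i, Measurable[mG] fun ω => g ω i := fun i => (measurable_pi_apply i).comp hgm
    have hgb : ∀ i ω, ‖g ω i‖ ≤ k := fun i ω => by
      by_cases hω : ω ∈ A
      · rw [hg, Set.indicator_of_mem hω]
        exact (Finset.single_le_sum (f := fun i => |h ω i|) (fun _ _ => abs_nonneg _)
          (Finset.mem_univ i)).trans hω
      · rw [hg, Set.indicator_of_notMem hω]
        simp
    have hint : ∀ (X : Ω → Fin n → ℝ), Integrable X μ → ∀ i,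
        Integrable (fun ω => g ω i * X ω i) μ := fun X hXi i =>
      (hXi.eval i).bdd_mul ((hgi i).mono hm le_rfl).aestronglyMeasurable
        (Filter.Eventually.of_forall (hgb i))
    have hdot : ∀ (X : Ω → Fin n → ℝ), Integrable X μ → Integrable (fun ω => g ω ⬝ᵥ X ω) μ :=
      fun X hXi => integrable_finsetSum _ fun i _ => hint X hXi i
    have heq : ∫ ω, g ω ⬝ᵥ X₁ ω ∂μ = ∫ ω, g ω ⬝ᵥ X₀ ω ∂μ := by
      simp only [dotProduct]
      rw [integral_finsetSum _ fun i _ => hint X₁ hX₁ i,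
        integral_finsetSum _ fun i _ => hint X₀ hX₀ i]
      refine Finset.sum_congr rfl fun i _ => ?_
      rw [← integral_condExp hm]
      refine integral_congr_ae ?_
      have h2 := condExp_stronglyMeasurable_mul_of_bound hm (hgi i).stronglyMeasurable
        (hX₁.eval i) k (Filter.Eventually.of_forall (hgb i))
      filter_upwards [h2, condExp_apply_ae_eq (m := mG) hX₁ i, hX] with ω a b c
      refine a.trans ?_
      rw [Pi.mul_apply, ← b, c]
    have hcase : ∀ ω (x : Fin n → ℝ), g ω ⬝ᵥ x = A.indicator (fun ω => h ω ⬝ᵥ x) ω := fun ω x => by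
      by_cases hω : ω ∈ A
      · rw [hg, Set.indicator_of_mem hω, Set.indicator_of_mem hω]
      · rw [hg, Set.indicator_of_notMem hω, Set.indicator_of_notMem hω, zero_dotProduct]
    have hle : ∀ᵐ ω ∂μ, 0 ≤ -(g ω ⬝ᵥ X₀ ω) := by
      filter_upwards [h0] with ω a
      rw [hcase]
      by_cases hω : ω ∈ A
      · rw [Set.indicator_of_mem hω]; linarith
      · rw [Set.indicator_of_notMem hω]; simp
    have hge : ∀ᵐ ω ∂μ, 0 ≤ g ω ⬝ᵥ X₁ ω := by
      filter_upwards [h1] with ω a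
      rw [hcase]
      by_cases hω : ω ∈ A
      · rw [Set.indicator_of_mem hω]; exact a
      · rw [Set.indicator_of_notMem hω]
    have e1 := integral_nonneg_of_ae hle
    have e2 := integral_nonneg_of_ae hge
    rw [integral_neg] at e1
    have z1 := (integral_eq_zero_iff_of_nonneg_ae hge (hdot X₁ hX₁)).1 (by linarith)
    have z0 := (integral_eq_zero_iff_of_nonneg_ae hle (hdot X₀ hX₀).neg).1 (by
      rw [integral_neg]; linarith)
    filter_upwards [z0, z1] with ω a b hω
    have hω : ω ∈ A := hω
    simp only [hcase, Set.indicator_of_mem hω, Pi.zero_apply, neg_eq_zero] at a b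
    exact ⟨a, b⟩
  have hall := ae_all_iff.2 key
  have hpair : ∀ᵐ ω ∂μ, h ω ⬝ᵥ X₀ ω = 0 ∧ h ω ⬝ᵥ X₁ ω = 0 := by
    filter_upwards [hall] with ω hω
    obtain ⟨k, hk⟩ := exists_nat_ge (∑ i, |h ω i|)
    exact hω k hk
  exact ⟨hpair.mono fun _ h => h.1, hpair.mono fun _ h => h.2⟩

/-- Multiplying the prices by positive random variables does not create or destroy arbitrage. -/
lemma OneStepNA.of_smul {P₀ P₁ : Ω → Fin n → ℝ} {Y₀ Y₁ : Ω → ℝ} (h₀ : ∀ᵐ ω ∂μ, 0 < Y₀ ω)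
    (h₁ : ∀ᵐ ω ∂μ, 0 < Y₁ ω)
    (hNA : OneStepNA μ mG (fun ω => Y₀ ω • P₀ ω) (fun ω => Y₁ ω • P₁ ω)) :
    OneStepNA μ mG P₀ P₁ := by
  intro h hh h0 h1
  obtain ⟨a, b⟩ := hNA h hh
    (by
      filter_upwards [h0, h₀] with ω a b
      rw [dotProduct_smul, smul_eq_mul]
      exact mul_nonpos_of_nonneg_of_nonpos b.le a)
    (by
      filter_upwards [h1, h₁] with ω a b
      rw [dotProduct_smul, smul_eq_mul]
      exact mul_nonneg b.le a)
  refine ⟨?_, ?_⟩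
  · filter_upwards [a, h₀] with ω a b
    rw [dotProduct_smul, smul_eq_mul] at a
    exact (mul_eq_zero.1 a).resolve_left b.ne'
  · filter_upwards [b, h₁] with ω a b
    rw [dotProduct_smul, smul_eq_mul] at a
    exact (mul_eq_zero.1 a).resolve_left b.ne'

variable {𝓕 : Filtration ℕ mΩ} {P : ℕ → Ω → Fin n → ℝ}

/-- On {t < τ_N}, which is known at time `t`, the stopped process agrees with `M` at both dates.
Restricting `h` to this event reduces to a martingale, and these events exhaust the space almost
surely. -/
lemma IsLocalMartingale.oneStepNA [IsFiniteMeasure μ] {M : ℕ → Ω → Fin n → ℝ}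
    (hM : IsLocalMartingale M 𝓕 μ) (t : ℕ) : OneStepNA μ (𝓕 t) (M t) (M (t + 1)) := by
  intro h hh h0 h1
  obtain ⟨-, τ, hτ, hmart⟩ := hM
  have key : ∀ N, ∀ᵐ ω ∂μ, (t : WithTop ℕ) < τ N ω →
      h ω ⬝ᵥ M t ω = 0 ∧ h ω ⬝ᵥ M (t + 1) ω = 0 := by
    intro N
    set A : Set Ω := {ω | (t : WithTop ℕ) < τ N ω} with hA
    have hAm : MeasurableSet[𝓕 t] A := (hτ.isStoppingTime N).measurableSet_gt t
    have e0 : ∀ ω ∈ A, stoppedProcess M (τ N) t ω = M t ω := fun ω hω =>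
      stoppedProcess_eq_of_le hω.le
    have e1 : ∀ ω ∈ A, stoppedProcess M (τ N) (t + 1) ω = M (t + 1) ω := fun ω hω =>
      stoppedProcess_eq_of_le (by
        have hlt : (t : WithTop ℕ) < τ N ω := hω
        change ((t + 1 : ℕ) : WithTop ℕ) ≤ τ N ω
        cases hτω : τ N ω with
        | top => exact le_top
        | coe s => rw [hτω] at hlt; exact WithTop.coe_le_coe.2 (WithTop.coe_lt_coe.1 hlt))
    obtain ⟨a, b⟩ := oneStepNA_of_condExp (𝓕.le t) ((hmart N).integrable t)
      ((hmart N).integrable (t + 1)) ((hmart N).2 t (t + 1) t.le_succ) (A.indicator h)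
      (hh.indicator hAm)
      (by
        filter_upwards [h0] with ω a
        by_cases hω : ω ∈ A
        · rw [Set.indicator_of_mem hω, e0 ω hω]; exact a
        · rw [Set.indicator_of_notMem hω, zero_dotProduct])
      (by
        filter_upwards [h1] with ω a
        by_cases hω : ω ∈ A
        · rw [Set.indicator_of_mem hω, e1 ω hω]; exact a
        · rw [Set.indicator_of_notMem hω, zero_dotProduct])
    filter_upwards [a, b] with ω a b hω
    have hω : ω ∈ A := hω
    rw [Set.indicator_of_mem hω] at a b
    rw [e0 ω hω] at a
    rw [e1 ω hω] at b
    exact ⟨a, b⟩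
  have hpair : ∀ᵐ ω ∂μ, h ω ⬝ᵥ M t ω = 0 ∧ h ω ⬝ᵥ M (t + 1) ω = 0 := by
    filter_upwards [ae_all_iff.2 key, hτ.tendsto_top] with ω a b
    obtain ⟨N, hN⟩ := (b.eventually (lt_mem_nhds (WithTop.coe_lt_top t))).exists
    exact a N hN
  exact ⟨hpair.mono fun _ h => h.1, hpair.mono fun _ h => h.2⟩

/-- A one-period arbitrage is an investment-consumption arbitrage. -/
lemma oneStepNA_of_not_isArbitrage (h : ¬ ∃ H, IsArbitrage 𝓕 μ P H) (t : ℕ) :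
    OneStepNA μ (𝓕 t) (P t) (P (t + 1)) := by
  intro k hk h0 h1
  -- Buy `k` at time `t` and liquidate at time `t + 1`: the consumption is `-k · P t`, then `k · P
  -- (t + 1)`.
  set H : ℕ → Ω → Fin n → ℝ := fun s => if s = t + 1 then k else 0 with hH
  have Ht : H (t + 1) = k := by simp [hH]
  have Hne : ∀ s, s ≠ t + 1 → H s = 0 := fun s hs => by simp [hH, hs]
  have hpred : IsStronglyPredictable 𝓕 H := by
    refine IsStronglyPredictable.of_measurable_add_one ?_ fun s => ?_
    · rw [Hne 0 (by omega)]; exact stronglyMeasurable_zero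
    · by_cases hs : s = t
      · subst hs; rw [Ht]; exact hk.stronglyMeasurable
      · rw [Hne (s + 1) (by omega)]; exact stronglyMeasurable_zero
  have hself : ∀ s, ∀ᵐ ω ∂μ, H (s + 1) ω ⬝ᵥ P s ω ≤ H s ω ⬝ᵥ P s ω := fun s => by
    rcases eq_or_ne s t with rfl | hs
    · rw [Ht, Hne s (by omega)]
      simpa using h0
    · rw [Hne (s + 1) (by omega)]
      rcases eq_or_ne s (t + 1) with rfl | hs'
      · rw [Ht]; simpa using h1
      · rw [Hne s hs']; simp
  by_contra hcon
  refine h ⟨H, Hne 0 (by omega), t + 1, by omega, ⟨⟨hpred, fun s _ => hself s⟩, ?_, ?_⟩, ?_⟩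
  · have := hself 0
    rw [Hne 0 (by omega)] at this
    simpa using this
  · rw [Hne (t + 1 + 1) (by omega)]; simp
  · rw [pos_iff_ne_zero]
    intro hz
    have hae : ∀ᵐ ω ∂μ, ¬ ∃ s, s ≤ t + 1 ∧ 0 < (H s ω - H (s + 1) ω) ⬝ᵥ P s ω :=
      measure_eq_zero_iff_ae_notMem.1 hz
    refine hcon ⟨?_, ?_⟩
    · filter_upwards [hae, h0] with ω a b
      push Not at a
      have c := a t (by omega)
      rw [Ht, Hne t (by omega), Pi.zero_apply, zero_sub, neg_dotProduct] at c
      linarith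
    · filter_upwards [hae, h1] with ω a b
      push Not at a
      have c := a (t + 1) le_rfl
      rw [Ht, Hne (t + 1 + 1) (by omega), Pi.zero_apply, sub_zero] at c
      linarith

lemma not_isArbitrage_of_oneStepNA (hP : ∀ t, Measurable[𝓕 t] (P t))
    (hNA : ∀ t, OneStepNA μ (𝓕 t) (P t) (P (t + 1))) : ¬ ∃ H, IsArbitrage 𝓕 μ P H := by
  rintro ⟨H, hH0, T, -, ⟨⟨hpred, hself⟩, hinit, hT⟩, hpos⟩
  have hHm : ∀ t, Measurable[𝓕 t] (H (t + 1)) := fun t => (hpred.measurable_add_one t).measurable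
  -- Backward from `H (T + 1) = 0`: the portfolio held can finance the next one, whose cost is
  -- non-negative, so by `OneStepNA.nonneg` its own cost is non-negative.
  have hnn : ∀ j t, t + j = T → ∀ᵐ ω ∂μ, 0 ≤ H (t + 1) ω ⬝ᵥ P t ω := by
    intro j
    induction j with
    | zero =>
      rintro t rfl
      filter_upwards [hT] with ω a
      rw [add_zero] at a
      rw [a, zero_dotProduct]
    | succ j ih =>
      intro t ht
      refine (hNA t).nonneg (hP t) (hHm t) ?_
      filter_upwards [ih (t + 1) (by omega), hself (t + 1) (by omega)] with ω a b
      exact a.trans b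
  -- Forward from the initial cost, which is both non-positive and non-negative: a portfolio of zero
  -- cost and non-negative value has zero value, and so the next one costs nothing.
  have hzero : ∀ t, t ≤ T → ∀ᵐ ω ∂μ, H t ω ⬝ᵥ P t ω = 0 ∧ H (t + 1) ω ⬝ᵥ P t ω = 0 := by
    intro t
    induction t with
    | zero =>
      intro _
      filter_upwards [hnn T 0 (by omega), hinit] with ω a b
      refine ⟨?_, le_antisymm b a⟩
      rw [hH0, Pi.zero_apply, zero_dotProduct]
    | succ t ih =>
      intro ht
      have h1 := hnn (T - (t + 1)) (t + 1) (by omega)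
      have h2 := hself (t + 1) (by omega)
      have h3 := (hNA t (H (t + 1)) (hHm t) ((ih (by omega)).mono fun ω h => h.2.le)
        (by filter_upwards [h1, h2] with ω a b using a.trans b)).2
      filter_upwards [h1, h2, h3] with ω a b c
      exact ⟨c, le_antisymm (b.trans_eq c) a⟩
  refine hpos.ne' (measure_eq_zero_iff_ae_notMem.2 ?_)
  have hall : ∀ᵐ ω ∂μ, ∀ t, t ≤ T → H t ω ⬝ᵥ P t ω = 0 ∧ H (t + 1) ω ⬝ᵥ P t ω = 0 :=
    ae_all_iff.2 fun t => by
      by_cases ht : t ≤ T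
      · filter_upwards [hzero t ht] with ω a _ using a
      · exact Filter.Eventually.of_forall fun ω h => absurd h ht
  filter_upwards [hall] with ω hω ⟨t, ht, hlt⟩
  rw [sub_dotProduct, (hω t ht).1, (hω t ht).2, sub_zero] at hlt
  exact lt_irrefl _ hlt

end NoArbitrage

/-! ### Construction of the deflators -/

section Deflators

variable {Ω : Type*} {mΩ : MeasurableSpace Ω} {μ : Measure Ω} {n : ℕ}
  {𝓕 : Filtration ℕ mΩ} {P : ℕ → Ω → Fin n → ℝ}

/-- Between the times `t` and `t + 1` there are deflators which are, up to a factor known at time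
`t`, as small as desired. -/
def HasOneStepDensity (𝓕 : Filtration ℕ mΩ) (μ : Measure Ω) (P : ℕ → Ω → Fin n → ℝ) (t : ℕ) :
    Prop :=
  ∀ ζ : Ω → ℝ, StronglyMeasurable[𝓕 (t + 1)] ζ → (∀ᵐ ω ∂μ, 0 < ζ ω) →
    ∃ Z R : Ω → ℝ, StronglyMeasurable[𝓕 (t + 1)] Z ∧ (∀ᵐ ω ∂μ, 0 < Z ω) ∧
      StronglyMeasurable[𝓕 t] R ∧ (∀ᵐ ω ∂μ, 0 < R ω) ∧
      (∀ᵐ ω ∂μ, Z ω ≤ R ω * ζ ω) ∧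
      ∀ i : Fin n, HasGenCondExp μ (𝓕 t) (fun ω => P (t + 1) ω i * Z ω) (fun ω => P t ω i)

lemma hasOneStepDensity_of_oneStepNA [IsFiniteMeasure μ] (hP : ∀ t, Measurable[𝓕 t] (P t)) {t : ℕ}
    (hNA : OneStepNA μ (𝓕 t) (P t) (P (t + 1))) : HasOneStepDensity 𝓕 μ P t := by
  intro ζ hζ hζ0
  obtain ⟨Z, R, hZ, hZ0, hR, hR0, hle, hE⟩ := hNA.exists_hasGenCondExp (𝓕.mono t.le_succ)
    (𝓕.le (t + 1)) (hP t) (hP (t + 1)) hζ.measurable hζ0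
  exact ⟨Z, R, hZ.stronglyMeasurable, hZ0, hR.stronglyMeasurable, hR0, hle, hE⟩

/-- Passing from a one-step deflator `Z` to a deflator `Y` of the price process. -/
lemma HasGenCondExp.deflate [IsFiniteMeasure μ] (hP : ∀ t, Measurable[𝓕 t] (P t)) {t : ℕ}
    {Y Z : Ω → ℝ}
    (hY : StronglyMeasurable[𝓕 t] Y) (hY0 : ∀ᵐ ω ∂μ, 0 < Y ω)
    (hZ : StronglyMeasurable[𝓕 (t + 1)] Z) {i : Fin n}
    (h : HasGenCondExp μ (𝓕 t) (fun ω => P (t + 1) ω i * Z ω) (fun ω => P t ω i)) :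
    HasGenCondExp μ (𝓕 t) (fun ω => ((Y ω * Z ω) • P (t + 1) ω) i) (fun ω => (Y ω • P t ω) i) := by
  have hX : Measurable (fun ω => P (t + 1) ω i * Z ω) :=
    ((measurable_pi_apply i).comp ((hP (t + 1)).mono (𝓕.le _) le_rfl)).mul
      (hZ.measurable.mono (𝓕.le _) le_rfl)
  refine (h.mul_left (𝓕.le t) hX.aemeasurable hY (hY0.mono fun _ h => h.le)).congr
    (Filter.Eventually.of_forall fun ω => ?_) (Filter.Eventually.of_forall fun ω => ?_)
  · simp only [Pi.smul_apply, smul_eq_mul]; ring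
  · simp only [Pi.smul_apply, smul_eq_mul]

/-- Products of one-step deflators, with no size condition imposed, form a generalised martingale
deflator; integrability is restored afterwards by a change of density. -/
lemma exists_isMartingaleDeflator [IsProbabilityMeasure μ] (hP : ∀ t, Measurable[𝓕 t] (P t))
    (h : ∀ t, HasOneStepDensity 𝓕 μ P t) : ∃ Y, IsMartingaleDeflator 𝓕 μ P Y := by
  choose Z R hZ hZ0 _ _ _ hE using fun t =>
    h t (fun _ => 1) stronglyMeasurable_const (Filter.Eventually.of_forall fun _ => one_pos)
  set Y : ℕ → Ω → ℝ := fun t ω => ∏ s ∈ Finset.range t, Z s ω with hYdef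
  have hYs : ∀ t, Y (t + 1) = fun ω => Y t ω * Z t ω := fun t => by
    ext ω; simp only [hYdef, Finset.prod_range_succ]
  have hY : ∀ t, StronglyMeasurable[𝓕 t] (Y t) := fun t => by
    induction t with
    | zero =>
      simp only [hYdef, Finset.range_zero, Finset.prod_empty]
      exact stronglyMeasurable_const
    | succ t ih => rw [hYs]; exact (ih.mono (𝓕.mono t.le_succ)).mul (hZ t)
  have hY0 : ∀ t, ∀ᵐ ω ∂μ, 0 < Y t ω := fun t => by
    filter_upwards [ae_all_iff.2 hZ0] with ω hω using Finset.prod_pos fun s _ => hω s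
  have hM : IsGenMartingale (fun t ω => Y t ω • P t ω) 𝓕 μ :=
    ⟨fun t => (hY t).measurable.smul (hP t), fun t i => by
      simp only [hYs]
      exact (hE t i).deflate hP (hY t) (hY0 t) (hZ t)⟩
  obtain ⟨L, hL, hL0, hLM⟩ := hM.exists_martingale
  refine ⟨fun t ω => L t ω * Y t ω, fun t => (hL t).stronglyMeasurable.mul (hY t), fun t => ?_, ?_⟩
  · filter_upwards [hL0 t, hY0 t] with ω a b using mul_pos a b
  · simpa only [smul_smul] using hLM

lemma integrable_smul_of_le_inv [IsFiniteMeasure μ] {Y : Ω → ℝ} {X : Ω → Fin n → ℝ}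
    (hY : Measurable Y) (hX : Measurable X) (hY0 : ∀ᵐ ω ∂μ, 0 < Y ω)
    (hle : ∀ᵐ ω ∂μ, Y ω ≤ (1 + ‖X ω‖)⁻¹) : Integrable (fun ω => Y ω • X ω) μ := by
  refine Integrable.of_bound (hY.smul hX).aestronglyMeasurable 1 ?_
  filter_upwards [hY0, hle] with ω a b
  have hpos : 0 < 1 + ‖X ω‖ := by positivity
  rw [norm_smul, Real.norm_of_nonneg a.le]
  calc Y ω * ‖X ω‖ ≤ (1 + ‖X ω‖)⁻¹ * (1 + ‖X ω‖) := by
        refine mul_le_mul b (by linarith) (norm_nonneg _) (by positivity)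
    _ = 1 := inv_mul_cancel₀ hpos.ne'

/-- Induction on the horizon with arbitrary bounds `η`. Capping `η` by 1 / (1 + ‖P‖) makes the
deflated prices bounded, so integrability is automatic. -/
lemma exists_isMartingaleDeflatorUpTo [IsFiniteMeasure μ] (hP : ∀ t, Measurable[𝓕 t] (P t))
    (h : ∀ t, HasOneStepDensity 𝓕 μ P t) (T : ℕ) :
    ∀ η : ℕ → Ω → ℝ, (∀ t ≤ T, StronglyMeasurable[𝓕 t] (η t)) →
      (∀ t ≤ T, ∀ᵐ ω ∂μ, 0 < η t ω) →
      ∃ Y, IsMartingaleDeflatorUpTo 𝓕 μ P T Y ∧ ∀ t ≤ T, ∀ᵐ ω ∂μ, Y t ω ≤ η t ω := by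
  have hinv : ∀ t, Measurable[𝓕 t] fun ω => (1 + ‖P t ω‖)⁻¹ := fun t =>
    ((measurable_const_add (1 : ℝ)).comp (measurable_norm.comp (hP t))).inv
  have hinv0 : ∀ t ω, 0 < (1 + ‖P t ω‖)⁻¹ := fun t ω => by positivity
  induction T with
  | zero =>
    intro η hη hη0
    have hY : Measurable[𝓕 0] fun ω => min (η 0 ω) (1 + ‖P 0 ω‖)⁻¹ :=
      (hη 0 le_rfl).measurable.min (hinv 0)
    have hY0 : ∀ᵐ ω ∂μ, 0 < min (η 0 ω) (1 + ‖P 0 ω‖)⁻¹ := by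
      filter_upwards [hη0 0 le_rfl] with ω a using lt_min a (hinv0 0 ω)
    have hint := integrable_smul_of_le_inv (hY.mono (𝓕.le 0) le_rfl)
      ((hP 0).mono (𝓕.le 0) le_rfl) hY0 (Filter.Eventually.of_forall fun ω => min_le_right _ _)
    refine ⟨fun _ ω => min (η 0 ω) (1 + ‖P 0 ω‖)⁻¹, ⟨?_, ?_, ?_, ?_⟩, ?_⟩
    · rintro t ht
      obtain rfl := Nat.le_zero.1 ht
      exact hY.stronglyMeasurable
    · exact fun _ _ => hY0
    · rintro t ht
      obtain rfl := Nat.le_zero.1 ht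
      exact hint
    · rintro s t hst ht
      obtain rfl := Nat.le_zero.1 ht
      obtain rfl := Nat.le_zero.1 hst
      exact (condExp_of_stronglyMeasurable (𝓕.le 0) (hY.smul (hP 0)).stronglyMeasurable
        hint).eventuallyEq
    · rintro t ht
      obtain rfl := Nat.le_zero.1 ht
      exact Filter.Eventually.of_forall fun ω => min_le_left _ _
  | succ T ih =>
    intro η hη hη0
    obtain ⟨Z, R, hZ, hZ0, hR, hR0, hZR, hE⟩ := h T
      (fun ω => min (η (T + 1) ω) (1 + ‖P (T + 1) ω‖)⁻¹)
      ((hη (T + 1) le_rfl).measurable.min (hinv (T + 1))).stronglyMeasurable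
      (by filter_upwards [hη0 (T + 1) le_rfl] with ω a using lt_min a (hinv0 (T + 1) ω))
    -- `Z` and `R` are chosen before `Y`: the extra demand that `Y` lie below 1 / R at time `T`
    -- turns `Z ≤ R ζ` into `Y Z ≤ ζ`.
    obtain ⟨Y, hY, hYη⟩ := ih (fun t => if t = T then fun ω => min (η T ω) (R ω)⁻¹ else η t)
      (fun t ht => by
        by_cases htT : t = T
        · subst htT
          simp only [if_true]
          exact ((hη t (by omega)).measurable.min hR.measurable.inv).stronglyMeasurable
        · simp only [htT, if_false]
          exact hη t (by omega))
      (fun t ht => by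
        by_cases htT : t = T
        · subst htT
          simp only [if_true]
          filter_upwards [hη0 t (by omega), hR0] with ω a b using lt_min a (inv_pos.2 b)
        · simp only [htT, if_false]
          exact hη0 t (by omega))
    have hYT : ∀ᵐ ω ∂μ, Y T ω ≤ min (η T ω) (R ω)⁻¹ := by simpa using hYη T le_rfl
    have hW : StronglyMeasurable[𝓕 (T + 1)] fun ω => Y T ω * Z ω :=
      ((hY.adapted T le_rfl).mono (𝓕.mono T.le_succ)).mul hZ
    have hW0 : ∀ᵐ ω ∂μ, 0 < Y T ω * Z ω := by
      filter_upwards [hY.pos T le_rfl, hZ0] with ω a b using mul_pos a b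
    have hWle : ∀ᵐ ω ∂μ, Y T ω * Z ω ≤ min (η (T + 1) ω) (1 + ‖P (T + 1) ω‖)⁻¹ := by
      filter_upwards [hYT, hZR, hZ0, hR0] with ω a b c d
      calc Y T ω * Z ω ≤ (R ω)⁻¹ * Z ω :=
            mul_le_mul_of_nonneg_right (a.trans (min_le_right _ _)) c.le
        _ ≤ (R ω)⁻¹ * (R ω * min (η (T + 1) ω) (1 + ‖P (T + 1) ω‖)⁻¹) :=
          mul_le_mul_of_nonneg_left b (inv_nonneg.2 d.le)
        _ = _ := inv_mul_cancel_left₀ d.ne' _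
    have hWint : Integrable (fun ω => (Y T ω * Z ω) • P (T + 1) ω) μ :=
      integrable_smul_of_le_inv (hW.measurable.mono (𝓕.le _) le_rfl)
        ((hP (T + 1)).mono (𝓕.le _) le_rfl) hW0 (hWle.mono fun ω a => a.trans (min_le_right _ _))
    have hstep : μ[fun ω => (Y T ω * Z ω) • P (T + 1) ω | 𝓕 T] =ᵐ[μ] fun ω => Y T ω • P T ω := by
      have hi : ∀ i, ∀ᵐ ω ∂μ, (μ[fun ω => (Y T ω * Z ω) • P (T + 1) ω | 𝓕 T]) ω i
          = (Y T ω • P T ω) i := fun i => by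
        filter_upwards [condExp_apply_ae_eq (m := 𝓕 T) hWint i,
          ((hE i).deflate hP (hY.adapted T le_rfl) (hY.pos T le_rfl) hZ).condExp_ae_eq
            (hWint.eval i)] with ω a b using a.trans b
      filter_upwards [ae_all_iff.2 hi] with ω hω using funext hω
    have hne : ∀ t ≤ T, Function.update Y (T + 1) (fun ω => Y T ω * Z ω) t = Y t := fun t ht =>
      Function.update_of_ne (by omega) _ _
    have heq : Function.update Y (T + 1) (fun ω => Y T ω * Z ω) (T + 1) = fun ω => Y T ω * Z ω :=
      Function.update_self _ _ _
    refine ⟨Function.update Y (T + 1) fun ω => Y T ω * Z ω, ⟨?_, ?_, ?_, ?_⟩, ?_⟩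
    · intro t ht
      rcases Nat.le_succ_iff.1 ht with ht | rfl
      · rw [hne t ht]; exact hY.adapted t ht
      · rw [heq]; exact hW
    · intro t ht
      rcases Nat.le_succ_iff.1 ht with ht | rfl
      · rw [hne t ht]; exact hY.pos t ht
      · rw [heq]; exact hW0
    · intro t ht
      rcases Nat.le_succ_iff.1 ht with ht | rfl
      · rw [hne t ht]; exact hY.integrable t ht
      · rw [heq]; exact hWint
    · intro s t hst ht
      rcases Nat.le_succ_iff.1 ht with ht | rfl
      · rw [hne t ht, hne s (hst.trans ht)]; exact hY.martingale s t hst ht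
      rcases Nat.le_succ_iff.1 hst with hs | rfl
      · rw [heq, hne s hs]
        exact ((condExp_condExp_of_le (𝓕.mono hs) (𝓕.le T)).symm.trans
          (condExp_congr_ae hstep)).trans (hY.martingale s T hs le_rfl)
      · rw [heq]
        exact (condExp_of_stronglyMeasurable (𝓕.le _)
          (hW.measurable.smul (hP (T + 1))).stronglyMeasurable hWint).eventuallyEq
    · intro t ht
      rcases Nat.le_succ_iff.1 ht with ht | rfl
      · rw [hne t ht]
        by_cases htT : t = T
        · subst htT
          filter_upwards [hYT] with ω a using a.trans (min_le_left _ _)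
        · simpa [htT] using hYη t ht
      · rw [heq]
        filter_upwards [hWle] with ω a using a.trans (min_le_left _ _)

lemma IsMartingaleDeflator.isLocalMartingaleDeflator {Y : ℕ → Ω → ℝ}
    (h : IsMartingaleDeflator 𝓕 μ P Y) : IsLocalMartingaleDeflator 𝓕 μ P Y :=
  ⟨h.adapted, h.pos, h.martingale.1, fun _ _ => ⊤, isLocalizingSequence_const_top 𝓕 μ, fun _ => by
    simpa only [stoppedProcess_const_top] using h.martingale⟩

lemma IsLocalMartingaleDeflator.oneStepNA [IsFiniteMeasure μ] {Y : ℕ → Ω → ℝ}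
    (h : IsLocalMartingaleDeflator 𝓕 μ P Y) (t : ℕ) : OneStepNA μ (𝓕 t) (P t) (P (t + 1)) :=
  (h.localMartingale.oneStepNA t).of_smul (h.pos t) (h.pos (t + 1))

lemma IsMartingaleDeflatorUpTo.oneStepNA [IsFiniteMeasure μ] {Y : ℕ → Ω → ℝ} {T t : ℕ}
    (h : IsMartingaleDeflatorUpTo 𝓕 μ P T Y) (ht : t < T) :
    OneStepNA μ (𝓕 t) (P t) (P (t + 1)) :=
  (oneStepNA_of_condExp (𝓕.le t) (h.integrable t ht.le) (h.integrable (t + 1) ht)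
    (h.martingale t (t + 1) t.le_succ ht)).of_smul (h.pos t ht.le) (h.pos (t + 1) ht)

end Deflators

end NumeraireFree

/-! ### The equivalence -/

theorem mainTheorem1 {Ω : Type*} {m : MeasurableSpace Ω} (μ : Measure Ω) [IsProbabilityMeasure μ]
    (𝓕 : Filtration ℕ m) (n : ℕ) (P : ℕ → Ω → (Fin n → ℝ)) (hP : StronglyAdapted 𝓕 P) :
    List.TFAE [
      -- (1) no investment-consumption arbitrage
      ¬ ∃ H : ℕ → Ω → (Fin n → ℝ), NumeraireFree.IsArbitrage 𝓕 μ P H,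
      -- (2) existence of a local martingale deflator
      ∃ Y : ℕ → Ω → ℝ, NumeraireFree.IsLocalMartingaleDeflator 𝓕 μ P Y,
      -- (3) existence of a martingale deflator
      ∃ Y : ℕ → Ω → ℝ, NumeraireFree.IsMartingaleDeflator 𝓕 μ P Y,
      -- (4) existence of arbitrarily small martingale deflators over every finite horizon
      ∀ T : ℕ, 0 < T → ∀ η : ℕ → Ω → ℝ,
        (∀ t ≤ T, StronglyMeasurable[𝓕 t] (η t)) → (∀ t ≤ T, ∀ᵐ ω ∂μ, 0 < η t ω) →
        ∃ Y : ℕ → Ω → ℝ, NumeraireFree.IsMartingaleDeflatorUpTo 𝓕 μ P T Y ∧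
          ∀ t ≤ T, ∀ᵐ ω ∂μ, Y t ω ≤ η t ω,
      -- (5) the one-step condition, between the times `t` and `t + 1`
      ∀ t : ℕ, ∀ ζ : Ω → ℝ, StronglyMeasurable[𝓕 (t + 1)] ζ → (∀ᵐ ω ∂μ, 0 < ζ ω) →
        ∃ Z R : Ω → ℝ, StronglyMeasurable[𝓕 (t + 1)] Z ∧ (∀ᵐ ω ∂μ, 0 < Z ω) ∧
          StronglyMeasurable[𝓕 t] R ∧ (∀ᵐ ω ∂μ, 0 < R ω) ∧
          (∀ᵐ ω ∂μ, Z ω ≤ R ω * ζ ω) ∧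
          ∀ i : Fin n, NumeraireFree.HasGenCondExp μ (𝓕 t)
            (fun ω => P (t + 1) ω i * Z ω) (fun ω => P t ω i)] := by
  have hPm : ∀ t, Measurable[𝓕 t] (P t) := fun t => (hP t).measurable
  tfae_have 1 → 5 := fun h t => NumeraireFree.hasOneStepDensity_of_oneStepNA hPm
    (NumeraireFree.oneStepNA_of_not_isArbitrage h t)
  tfae_have 5 → 3 := NumeraireFree.exists_isMartingaleDeflator hPm
  tfae_have 3 → 2 := fun ⟨Y, hY⟩ => ⟨Y, hY.isLocalMartingaleDeflator⟩
  tfae_have 2 → 1 := fun ⟨_, hY⟩ => NumeraireFree.not_isArbitrage_of_oneStepNA hPm hY.oneStepNA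
  tfae_have 5 → 4 := fun h T _ => NumeraireFree.exists_isMartingaleDeflatorUpTo hPm h T
  tfae_have 4 → 1 := fun h => NumeraireFree.not_isArbitrage_of_oneStepNA hPm fun t => by
    -- Only existence matters here, so any bound will do; horizon `t + 1` covers the period from `t`
    -- to `t + 1`.
    obtain ⟨Y, hY, -⟩ := h (t + 1) t.succ_pos (fun _ _ => 1)
      (fun _ _ => stronglyMeasurable_const) fun _ _ => Filter.Eventually.of_forall fun _ => one_pos
    exact hY.oneStepNA t.lt_succ_self
  tfae_finish
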